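/- **Proposition 2.1.** Let $S=(S_k)_{k\ge 0}$ be a $\mathbb Z$-valued random sequence (no independence or random walk structure is assumed), and let $$N(n,x)=\mathrm{card}\{k\in\{0,\dots,n\}: S_k=x\}\qquad (n\in\mathbb N,\ x\in\mathbb Z)$$ be its discrete local time. Write $[\cdot]$ for the integer part (floor). Suppose that: * **(RW1)** there is a real sequence $(a_n)$ with $a_n\to\infty$ and $n^{-1}a_n\to 0$ such that the processes $(a_n^{-1}S_{[nt]})_{t\ge 0}$ converge in law, as $n\to\infty$, in the space $\mathcal D([0,\infty))$ of real càdlàg functions with the Skorokhod ($J_1$) topology, to a process $(Y_t)_{t\ge 0}$ admitting a local time $(L(t,x))_{t\ge 0,\,x\in\mathbb R}$. That is, $L\ge 0$ is finite, for every $t\ge 0$ the map $(x,\omega)\mapsto L(t,x)(\omega)$ is measurable and, almost surely, $\mathrm{Leb}\{s\in[0,t]:Y_s\in B\}=\int_B L(t,x)\,dx$ for every Borel set $B\subseteq\mathbb R$; * **(RW2)** there is some $p\in[1,\infty)$ such that, for all $t>0$ and all $M>0$, $$\lim_{\delta\downarrow 0}\ \limsup_{n\to\infty}\int_{[-M,M]}\mathbb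 E\,\bigl|L_n(t,x)-L_n(t,[x]_\delta)\bigr|^p\,dx=0,$$ where $L_n(t,x)=n^{-1}a_n\,N([nt],[a_nx])$ is the rescaled discrete local time and $[x]_\delta=\delta[\delta^{-1}x]$. Then, for every $m\ge 1$, all $\theta_1,\dots,\theta_m\in\mathbb R$ and all $0<t_1<\dots<t_m$, the function $\sum_{i=1}^m\theta_iL(t_i,\cdot)$ almost surely belongs to $L^p(\mathbb R)$, and, for the same $p$ as in (RW2), $$\sum_{i=1}^m\theta_iL_n(t_i,\cdot)\ \Longrightarrow\ \sum_{i=1}^m\theta_iL(t_i,\cdot)\qquad (n\to\infty)$$ in law in the Banach space $L^p(\mathbb R)$. -/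

import Mathlib

open MeasureTheory ProbabilityTheory Filter Topology Set
open scoped NNReal ENNReal

noncomputable section

/-- `x : [0,∞) → ℝ` is càdlàg: right-continuous with a left limit at every time
(at time `0` the left-limit condition is void). -/
def IsCadlag (x : ℝ≥0 → ℝ) : Prop :=
  ∀ t : ℝ≥0, ContinuousWithinAt x (Ici t) t ∧ ∃ l : ℝ, Tendsto x (𝓝[<] t) (𝓝 l)

/-- The space `D([0,∞))` of real càdlàg functions on `[0,∞)`. -/
def SkorokhodSpace : Type := {x : ℝ≥0 → ℝ // IsCadlag x}

namespace SkorokhodSpace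

instance : CoeFun SkorokhodSpace (fun _ => ℝ≥0 → ℝ) := ⟨Subtype.val⟩

/-- The functions `y` that are `ε`-close to `x` on `[0,T]` after a time change `τ`, an increasing
bijection of `[0,∞)` that moves every time by less than `ε`. -/
def basicNhd (x : SkorokhodSpace) (T : ℝ≥0) (ε : ℝ) : Set SkorokhodSpace :=
  {y | ∃ τ : ℝ≥0 ≃o ℝ≥0, (∀ t, dist (τ t) t < ε) ∧ ∀ t ≤ T, dist (y (τ t)) (x t) < ε}

theorem basicNhd_mono (x : SkorokhodSpace) {T T' : ℝ≥0} {ε ε' : ℝ} (hT : T' ≤ T) (hε : ε ≤ ε') :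
    basicNhd x T ε ⊆ basicNhd x T' ε' := by
  rintro y ⟨τ, h1, h2⟩
  exact ⟨τ, fun t => (h1 t).trans_le hε, fun t ht => (h2 t (ht.trans hT)).trans_le hε⟩

/-- The Skorokhod (`J₁`) topology on `D([0,∞))`. A sequence `xₙ` converges to `x` if and only if
there are time changes `τₙ` with `sup_t |τₙ t - t| → 0` and
`sup_{t ≤ T} |xₙ (τₙ t) - x t| → 0` for every `T`. -/
instance : TopologicalSpace SkorokhodSpace where
  IsOpen U := ∀ x ∈ U, ∃ T : ℝ≥0, ∃ ε : ℝ, 0 < ε ∧ basicNhd x T ε ⊆ U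
  isOpen_univ := fun _ _ => ⟨0, 1, one_pos, subset_univ _⟩
  isOpen_inter := by
    intro U V hU hV x hx
    obtain ⟨T, ε, hε, h⟩ := hU x hx.1
    obtain ⟨T', ε', hε', h'⟩ := hV x hx.2
    exact ⟨max T T', min ε ε', lt_min hε hε', subset_inter
      ((basicNhd_mono x (le_max_left _ _) (min_le_left _ _)).trans h)
      ((basicNhd_mono x (le_max_right _ _) (min_le_right _ _)).trans h')⟩
  isOpen_sUnion := by
    intro 𝒰 h𝒰 x hx
    obtain ⟨U, hU, hxU⟩ := hx
    obtain ⟨T, ε, hε, h⟩ := h𝒰 U hU x hxU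
    exact ⟨T, ε, hε, h.trans (subset_sUnion_of_mem hU)⟩

instance : MeasurableSpace SkorokhodSpace := borel _

instance : BorelSpace SkorokhodSpace := ⟨rfl⟩

end SkorokhodSpace

/-- The Borel `σ`-algebra of the Banach space `L^p(ℝ)`. -/
instance instMeasurableSpaceLpReal (p : ℝ≥0∞) [Fact (1 ≤ p)] :
    MeasurableSpace (Lp ℝ p (volume : Measure ℝ)) := borel _

instance instBorelSpaceLpReal (p : ℝ≥0∞) [Fact (1 ≤ p)] :
    BorelSpace (Lp ℝ p (volume : Measure ℝ)) := ⟨rfl⟩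

theorem isCadlag_floor_mul (c : ℝ≥0) (s : ℕ → ℝ) : IsCadlag (fun t => s ⌊c * t⌋₊) := by
  intro t
  constructor
  · have h : ∀ᶠ u in 𝓝[≥] t, ⌊c * u⌋₊ = ⌊c * t⌋₊ := by
      have h1 : ∀ᶠ u in 𝓝 t, c * u < ⌊c * t⌋₊ + 1 :=
        (continuous_const.mul continuous_id).continuousAt.eventually_lt continuousAt_const
          (Nat.lt_floor_add_one _)
      filter_upwards [mem_nhdsWithin_of_mem_nhds h1, self_mem_nhdsWithin] with u hu hu'
      refine (Nat.floor_eq_iff (by positivity)).2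
        ⟨(Nat.floor_le (by positivity)).trans (mul_le_mul_right (mem_Ici.1 hu') c), hu⟩
    exact tendsto_const_nhds.congr' (h.mono fun u hu => by simp only [hu])
  · have h : ∀ᶠ u in 𝓝[<] t, ⌊c * u⌋₊ = ⌈c * t⌉₊ - 1 := by
      rcases eq_or_ne c 0 with rfl | hc
      · simp
      rcases eq_or_ne t 0 with rfl | ht
      · simp
      have hpos : 0 < c * t := by positivity
      have hceil : 0 < ⌈c * t⌉₊ := Nat.ceil_pos.2 hpos
      have hlt : ((⌈c * t⌉₊ - 1 : ℕ) : ℝ≥0) < c * t := Nat.lt_ceil.1 (by omega)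
      have h1 : ∀ᶠ u in 𝓝 t, ((⌈c * t⌉₊ - 1 : ℕ) : ℝ≥0) < c * u :=
        continuousAt_const.eventually_lt (continuous_const.mul continuous_id).continuousAt hlt
      filter_upwards [mem_nhdsWithin_of_mem_nhds h1, self_mem_nhdsWithin] with u hu hu'
      refine (Nat.floor_eq_iff (by positivity)).2 ⟨hu.le, ?_⟩
      have h2 : c * u < c * t := mul_lt_mul_of_pos_left (mem_Iio.1 hu') (by positivity)
      have h3 : ((⌈c * t⌉₊ - 1 : ℕ) : ℝ≥0) + 1 = (⌈c * t⌉₊ : ℝ≥0) := by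
        exact_mod_cast Nat.sub_add_cancel hceil
      rw [h3]
      exact h2.trans_le (Nat.le_ceil _)
    exact ⟨s (⌈c * t⌉₊ - 1), tendsto_const_nhds.congr' (h.mono fun u hu => by simp only [hu])⟩

/-- The rescaled path `t ↦ a⁻¹ s_[nt]`, an element of `D([0,∞))`. -/
def rescaledPath (a : ℝ) (n : ℕ) (s : ℕ → ℤ) : SkorokhodSpace :=
  ⟨fun t => a⁻¹ * (s ⌊(n : ℝ≥0) * t⌋₊ : ℝ), isCadlag_floor_mul n fun k => a⁻¹ * (s k : ℝ)⟩

/-- The discrete local time `N(n,x) = card {k ∈ {0,…,n} : s_k = x}`. -/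
def discreteLocalTime (s : ℕ → ℤ) (n : ℕ) (x : ℤ) : ℕ :=
  ((Finset.range (n + 1)).filter fun k => s k = x).card

/-- The rescaled discrete local time `n⁻¹ a N([nt],[a x])`. -/
def rescaledLocalTime (a : ℝ) (n : ℕ) (s : ℕ → ℤ) (t : ℝ≥0) (x : ℝ) : ℝ :=
  (n : ℝ)⁻¹ * a * (discreteLocalTime s ⌊(n : ℝ≥0) * t⌋₊ ⌊a * x⌋ : ℝ)

/-- The discretization `[x]_δ = δ [δ⁻¹ x]`. -/
def gridFloor (δ x : ℝ) : ℝ := δ * (⌊δ⁻¹ * x⌋ : ℝ)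

/-- `L` is a local time of the process `Y`: for every `t`, almost surely, `L(t,·)` is a density,
with respect to Lebesgue measure, of the occupation measure
`B ↦ Leb {s ∈ [0,t] : Y_s ∈ B}` of `Y` up to time `t`. -/
structure IsLocalTime {Ω : Type*} [MeasurableSpace Ω] (P : Measure Ω) (Y : Ω → SkorokhodSpace)
    (L : ℝ≥0 → ℝ → Ω → ℝ) : Prop where
  measurable : ∀ t, Measurable fun z : ℝ × Ω => L t z.1 z.2
  nonneg : ∀ t x ω, 0 ≤ L t x ω
  occupation : ∀ t : ℝ≥0, ∀ᵐ ω ∂P, ∀ B : Set ℝ, MeasurableSet B →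
    volume {s : ℝ | 0 ≤ s ∧ s ≤ (t : ℝ) ∧ Y ω s.toNNReal ∈ B} = ∫⁻ x in B, ENNReal.ofReal (L t x ω)

end

/-!
The integral of a continuous function against the occupation measure of a path is a continuous
functional of the path in the Skorokhod topology, even though the occupation density, if there is
one, is not. Hence the step functions obtained by averaging the occupation measure over the cells
of a grid converge in law. By (RW2) and Jensen's inequality the discrete local time is close in
`L^p` of a bounded window to these step functions, uniformly in `n`, as the mesh tends to `0`. So
the step functions of the limit path form a Cauchy sequence, and by Lebesgue differentiation and
Fatou's lemma they approximate `L` equally well; this is also why `L` is in `L^p`. A uniform bound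
on the supremum of the paths makes the contribution outside a large window negligible, and
approximation in the metric `E[min(1, d)]` of convergence in probability finishes the proof.
-/

/-! ### Càdlàg functions -/

theorem IsCadlag.measurable {x : ℝ≥0 → ℝ} (hx : IsCadlag x) : Measurable x := by
  let u (k : ℕ) (t : ℝ≥0) : ℝ≥0 := (⌊((k + 1 : ℕ) : ℝ≥0) * t⌋₊ + 1) / (k + 1 : ℕ)
  have le_u (k : ℕ) (t : ℝ≥0) : t ≤ u k t := by
    rw [le_div_iff₀ (by positivity), mul_comm]
    exact (Nat.lt_floor_add_one _).le
  have u_le (k : ℕ) (t : ℝ≥0) : u k t ≤ t + 1 / ((k : ℝ≥0) + 1) := by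
    simp only [u, add_div, Nat.cast_add_one]
    gcongr
    rw [div_le_iff₀ (by positivity), mul_comm]
    exact Nat.floor_le (by positivity)
  have tendsto_u (t : ℝ≥0) : Tendsto (u · t) atTop (𝓝[≥] t) := by
    refine tendsto_nhdsWithin_iff.2 ⟨?_, Eventually.of_forall (le_u · t)⟩
    refine tendsto_of_tendsto_of_tendsto_of_le_of_le tendsto_const_nhds ?_ (le_u · t) (u_le · t)
    simpa using (tendsto_const_nhds (x := t)).add
      (tendsto_one_div_add_atTop_nhds_zero_nat (𝕜 := ℝ≥0))
  refine measurable_of_tendsto_metrizable (f := fun k t => x (u k t)) (fun k => ?_)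
    (tendsto_pi_nhds.2 fun t => (hx t).1.tendsto.comp (tendsto_u t))
  exact (measurable_from_nat (f := fun j : ℕ => x (((j : ℝ≥0) + 1) / (k + 1 : ℕ)))).comp
    (Nat.measurable_floor.comp (measurable_const_mul _))

theorem countable_setOf_left_limit_lt {α : Type*} [TopologicalSpace α] [LinearOrder α]
    [OrderTopology α] [SecondCountableTopology α] (x : α → ℝ) :
    {t | ∃ l, Tendsto x (𝓝[<] t) (𝓝 l) ∧ l < x t}.Countable := by
  let s (q : ℚ) : Set α := {t | (∀ᶠ u in 𝓝[<] t, x u < q) ∧ q < x t}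
  have hs (q : ℚ) : (s q).Countable := by
    refine (countable_setOfPred_isolated_left_within (s := s q)).mono fun t ht => ?_
    refine ⟨ht, ?_⟩
    rw [← empty_mem_iff_bot]
    filter_upwards [nhdsWithin_mono t (inter_subset_right (s := s q)) ht.1,
      self_mem_nhdsWithin] with u hu hu'
    exact lt_asymm hu hu'.1.2
  refine (countable_iUnion hs).mono ?_
  rintro t ⟨l, hl, hlt⟩
  obtain ⟨q, hlq, hqt⟩ := exists_rat_btwn hlt
  exact mem_iUnion.2 ⟨q, hl.eventually (gt_mem_nhds hlq), hqt⟩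

theorem IsCadlag.countable_not_continuousAt {x : ℝ≥0 → ℝ} (hx : IsCadlag x) :
    {t | ¬ ContinuousAt x t}.Countable := by
  refine ((countable_setOf_left_limit_lt x).union
    (countable_setOf_left_limit_lt fun t => -x t)).mono fun t ht => ?_
  obtain ⟨hr, l, hl⟩ := hx t
  have hne : l ≠ x t := by
    rintro rfl
    exact ht (continuousAt_iff_continuous_left'_right'.2 ⟨hl, hr.mono Ioi_subset_Ici_self⟩)
  rcases hne.lt_or_gt with h | h
  · exact Or.inl ⟨l, hl, h⟩
  · exact Or.inr ⟨-l, hl.neg, neg_lt_neg h⟩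

theorem IsCadlag.exists_abs_le {x : ℝ≥0 → ℝ} (hx : IsCadlag x) (T : ℝ≥0) :
    ∃ C, ∀ t ≤ T, |x t| ≤ C := by
  suffices h : ∃ C, ∀ t ∈ Icc 0 T, |x t| ≤ C by
    obtain ⟨C, hC⟩ := h
    exact ⟨C, fun t ht => hC t ⟨zero_le, ht⟩⟩
  refine isCompact_Icc.induction_on (p := fun s => ∃ C, ∀ t ∈ s, |x t| ≤ C) ⟨0, by simp⟩ ?_ ?_ ?_
  · rintro s t hst ⟨C, hC⟩
    exact ⟨C, fun u hu => hC u (hst hu)⟩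
  · rintro s t ⟨C, hC⟩ ⟨C', hC'⟩
    exact ⟨max C C', fun u hu => hu.elim (fun h => (hC u h).trans (le_max_left _ _))
      fun h => (hC' u h).trans (le_max_right _ _)⟩
  · intro t _
    obtain ⟨hr, l, hl⟩ := hx t
    have right : ∀ᶠ u in 𝓝[≥] t, |x u| < |x t| + 1 :=
      hr.tendsto.abs.eventually (gt_mem_nhds (lt_add_one _))
    have left : ∀ᶠ u in 𝓝[<] t, |x u| < |l| + 1 := hl.abs.eventually (gt_mem_nhds (lt_add_one _))
    refine ⟨{u | |x u| ≤ max (|x t| + 1) (|l| + 1)}, mem_nhdsWithin_of_mem_nhds ?_, _,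
      fun u hu => hu⟩
    rw [← nhdsLT_sup_nhdsGE t]
    exact ⟨left.mono fun u hu => hu.le.trans (le_max_right _ _),
      right.mono fun u hu => hu.le.trans (le_max_left _ _)⟩

/-! ### Continuous functionals on the Skorokhod space -/

namespace SkorokhodSpace

theorem measurable_coe (x : SkorokhodSpace) : Measurable (x : ℝ≥0 → ℝ) := x.2.measurable

theorem measurable_path (x : SkorokhodSpace) : Measurable fun s : ℝ => x s.toNNReal :=
  x.measurable_coe.comp measurable_real_toNNReal

theorem ae_continuousAt (x : SkorokhodSpace) : ∀ᵐ s : ℝ, 0 ≤ s → ContinuousAt x s.toNNReal := by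
  have h : ((↑) '' {t : ℝ≥0 | ¬ ContinuousAt x t} : Set ℝ).Countable :=
    x.2.countable_not_continuousAt.image _
  filter_upwards [h.ae_notMem volume] with s hs hs0
  by_contra hc
  exact hs ⟨s.toNNReal, hc, Real.coe_toNNReal s hs0⟩

theorem continuous_of_tendsto {E : Type*} [TopologicalSpace E] {f : SkorokhodSpace → E}
    (h : ∀ (x : SkorokhodSpace) (y : ℕ → SkorokhodSpace),
      (∀ n : ℕ, y n ∈ basicNhd x n (1 / ((n : ℝ) + 1))) →
        Tendsto (fun n => f (y n)) atTop (𝓝 (f x))) :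
    Continuous f := by
  refine ⟨fun U hU x hx => ?_⟩
  by_contra! hcon
  choose y hy hyU using fun n : ℕ =>
    not_subset.1 (hcon n (1 / ((n : ℝ) + 1)) Nat.one_div_pos_of_nat)
  obtain ⟨n, hn⟩ := ((h x y hy).eventually (hU.mem_nhds hx)).exists
  exact hyU n hn

theorem tendsto_apply_of_mem_basicNhd {x : SkorokhodSpace} {y : ℕ → SkorokhodSpace}
    (hy : ∀ n : ℕ, y n ∈ basicNhd x n (1 / ((n : ℝ) + 1))) {s : ℝ≥0} (hs : ContinuousAt x s) :
    Tendsto (fun n => y n s) atTop (𝓝 (x s)) := by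
  choose τ hτ hyx using hy
  have h0 : Tendsto (fun n : ℕ => 1 / ((n : ℝ) + 1)) atTop (𝓝 0) :=
    tendsto_one_div_add_atTop_nhds_zero_nat
  have hsymm : Tendsto (fun n => (τ n).symm s) atTop (𝓝 s) := by
    refine tendsto_iff_dist_tendsto_zero.2 (squeeze_zero (fun _ => dist_nonneg) (fun n => ?_) h0)
    simpa [dist_comm] using (hτ n ((τ n).symm s)).le
  have hdist : Tendsto (fun n => dist (y n s) (x ((τ n).symm s))) atTop (𝓝 0) := by
    refine squeeze_zero' (Eventually.of_forall fun _ => dist_nonneg) ?_ h0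
    filter_upwards [hsymm.eventually (Iic_mem_nhds (lt_add_one s)),
      tendsto_natCast_atTop_atTop.eventually_ge_atTop (s + 1)] with n hn hn'
    simpa using (hyx n ((τ n).symm s) (hn.trans hn')).le
  exact (tendsto_iff_of_dist hdist).2 (hs.tendsto.comp hsymm)

/-- The integral `∫_0^t ψ (x s) ds` of `ψ` against the occupation measure of `x`. -/
noncomputable def occupationIntegral (ψ : ℝ → ℝ) (t : ℝ≥0) (x : SkorokhodSpace) : ℝ :=
  ∫ s in Icc (0 : ℝ) t, ψ (x s.toNNReal)

theorem continuous_occupationIntegral {ψ : ℝ → ℝ} (hψ : Continuous ψ) {C : ℝ}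
    (hC : ∀ u, |ψ u| ≤ C) (t : ℝ≥0) : Continuous (occupationIntegral ψ t) := by
  refine continuous_of_tendsto fun x y hy => ?_
  refine tendsto_integral_of_dominated_convergence (fun _ => C)
    (fun n => (hψ.measurable.comp (y n).measurable_path).aestronglyMeasurable)
    (integrable_const C) (fun n => ae_of_all _ fun s => hC _) ?_
  filter_upwards [ae_restrict_of_ae x.ae_continuousAt, ae_restrict_mem measurableSet_Icc]
    with s hs hs'
  exact (hψ.tendsto _).comp (tendsto_apply_of_mem_basicNhd hy (hs hs'.1))

/-- The running supremum `sup_{r ≤ s} |x r|`. The time `s` is real, so that the running supremum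
can be integrated; a negative `s` counts as `0`. -/
noncomputable def runningSup (x : SkorokhodSpace) (s : ℝ) : ℝ := ⨆ r : Iic s.toNNReal, |x r|

theorem abs_le_runningSup (x : SkorokhodSpace) {r : ℝ≥0} {s : ℝ} (h : r ≤ s.toNNReal) :
    |x r| ≤ runningSup x s := by
  obtain ⟨C, hC⟩ := x.2.exists_abs_le s.toNNReal
  have hbdd : BddAbove (range fun r : Iic s.toNNReal => |x r|) :=
    ⟨C, forall_mem_range.2 fun r => hC r r.2⟩
  exact le_ciSup hbdd ⟨r, h⟩

theorem runningSup_le {x : SkorokhodSpace} {s : ℝ} (hs : 0 ≤ s) {C : ℝ}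
    (h : ∀ r : ℝ≥0, r ≤ s → |x r| ≤ C) : runningSup x s ≤ C :=
  ciSup_le fun r => h r ((Real.le_toNNReal_iff_coe_le hs).1 r.2)

theorem runningSup_nonneg (x : SkorokhodSpace) (s : ℝ) : 0 ≤ runningSup x s :=
  Real.iSup_nonneg fun _ => abs_nonneg _

theorem monotone_runningSup (x : SkorokhodSpace) : Monotone (runningSup x) := fun _ _ h =>
  ciSup_le fun r => abs_le_runningSup x (r.2.trans (Real.toNNReal_mono h))

theorem runningSup_le_of_mem_basicNhd {x y : SkorokhodSpace} {T : ℝ≥0} {ε : ℝ}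
    (hy : y ∈ basicNhd x T ε) {s : ℝ} (hs : 0 ≤ s) (hsT : s + ε ≤ T) :
    runningSup y s ≤ runningSup x (s + ε) + ε := by
  obtain ⟨τ, hτ, hyx⟩ := hy
  refine runningSup_le hs fun r hr => ?_
  obtain ⟨r, rfl⟩ := τ.surjective r
  have hrs : (r : ℝ) ≤ s + ε := by
    have hr' : |(τ r : ℝ) - r| < ε := hτ r
    have := (abs_lt.1 hr').1
    linarith
  have hdist := (abs_lt.1 ((abs_abs_sub_abs_le _ _).trans_lt
    (hyx r (by exact_mod_cast hrs.trans hsT)))).2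
  linarith [abs_le_runningSup x (NNReal.le_toNNReal_of_coe_le hrs)]

theorem runningSup_sub_le_of_mem_basicNhd {x y : SkorokhodSpace} {T : ℝ≥0} {ε : ℝ}
    (hy : y ∈ basicNhd x T ε) {s : ℝ} (hs : ε ≤ s) (hsT : s - ε ≤ T) :
    runningSup x (s - ε) ≤ runningSup y s + ε := by
  obtain ⟨τ, hτ, hyx⟩ := hy
  refine runningSup_le (sub_nonneg.2 hs) fun r hr => ?_
  have hrs : (τ r : ℝ) ≤ s := by
    have hr' : |(τ r : ℝ) - r| < ε := hτ r
    have := (abs_lt.1 hr').2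
    linarith
  have hdist := (abs_lt.1 ((abs_abs_sub_abs_le _ _).trans_lt
    (hyx r (by exact_mod_cast hr.trans hsT)))).1
  linarith [abs_le_runningSup y (NNReal.le_toNNReal_of_coe_le hrs)]

theorem tendsto_runningSup_of_mem_basicNhd {x : SkorokhodSpace} {y : ℕ → SkorokhodSpace}
    (hy : ∀ n : ℕ, y n ∈ basicNhd x n (1 / ((n : ℝ) + 1))) {s : ℝ} (hs : 0 < s)
    (hc : ContinuousAt (runningSup x) s) :
    Tendsto (fun n => runningSup (y n) s) atTop (𝓝 (runningSup x s)) := by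
  have h0 : Tendsto (fun n : ℕ => 1 / ((n : ℝ) + 1)) atTop (𝓝 0) :=
    tendsto_one_div_add_atTop_nhds_zero_nat
  have lower : Tendsto (fun n : ℕ => runningSup x (s - 1 / ((n : ℝ) + 1)) - 1 / ((n : ℝ) + 1))
      atTop (𝓝 (runningSup x s)) := by
    simpa using (hc.tendsto.comp (by simpa using h0.const_sub s)).sub h0
  have upper : Tendsto (fun n : ℕ => runningSup x (s + 1 / ((n : ℝ) + 1)) + 1 / ((n : ℝ) + 1))
      atTop (𝓝 (runningSup x s)) := by
    simpa using (hc.tendsto.comp (by simpa using h0.const_add s)).add h0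
  refine tendsto_of_tendsto_of_tendsto_of_le_of_le' lower upper ?_ ?_
  all_goals
    filter_upwards [h0.eventually (ge_mem_nhds (lt_min hs one_pos)),
      tendsto_natCast_atTop_atTop.eventually_ge_atTop (s + 1)] with n hn hn'
    have hsn : 1 / ((n : ℝ) + 1) ≤ s := hn.trans (min_le_left _ _)
    have h1n : 1 / ((n : ℝ) + 1) ≤ 1 := hn.trans (min_le_right _ _)
  · have := runningSup_sub_le_of_mem_basicNhd (hy n) hsn
      (by push_cast; linarith [Nat.one_div_pos_of_nat (α := ℝ) (n := n)])
    linarith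
  · exact runningSup_le_of_mem_basicNhd (hy n) hs.le (by push_cast; linarith)

/-- The average of the running supremum over `[t, t + 1]`, which dominates `|x|` on `[0, t]` and,
unlike the running supremum at a fixed time, is continuous in the Skorokhod topology. -/
noncomputable def averagedSup (t : ℝ≥0) (x : SkorokhodSpace) : ℝ :=
  ∫ s in (t : ℝ)..t + 1, runningSup x s

theorem abs_le_averagedSup (x : SkorokhodSpace) {r t : ℝ≥0} (h : r ≤ t) :
    |x r| ≤ averagedSup t x := by
  have hconst : ∫ _ in (t : ℝ)..t + 1, |x r| = |x r| := by simp
  rw [averagedSup, ← hconst]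
  refine intervalIntegral.integral_mono_on (by linarith) intervalIntegrable_const
    (monotone_runningSup x).intervalIntegrable fun s hs => abs_le_runningSup x ?_
  exact NNReal.le_toNNReal_of_coe_le ((NNReal.coe_le_coe.2 h).trans hs.1)

theorem continuous_averagedSup (t : ℝ≥0) : Continuous (averagedSup t) := by
  refine continuous_of_tendsto fun x y hy => ?_
  refine intervalIntegral.tendsto_integral_filter_of_dominated_convergence
    (fun _ => runningSup x (t + 2) + 1)
    (Eventually.of_forall fun n => (monotone_runningSup (y n)).measurable.aestronglyMeasurable)
    ?_ intervalIntegrable_const ?_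
  · filter_upwards [tendsto_natCast_atTop_atTop.eventually_ge_atTop ((t : ℝ) + 2)] with n hn
    refine ae_of_all _ fun s hs => ?_
    rw [uIoc_of_le (by linarith)] at hs
    have h1 : 1 / ((n : ℝ) + 1) ≤ 1 := by
      rw [div_le_one (by positivity)]
      linarith [n.cast_nonneg (α := ℝ)]
    rw [Real.norm_of_nonneg (runningSup_nonneg _ _)]
    have hle := runningSup_le_of_mem_basicNhd (hy n) (t.coe_nonneg.trans hs.1.le)
      (by push_cast; linarith [hs.2])
    have hmono := monotone_runningSup x (show s + 1 / ((n : ℝ) + 1) ≤ t + 2 by linarith [hs.2])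
    linarith
  · filter_upwards [(monotone_runningSup x).countable_not_continuousAt.ae_notMem volume]
      with s hs hst
    rw [uIoc_of_le (by linarith)] at hst
    exact tendsto_runningSup_of_mem_basicNhd hy (t.coe_nonneg.trans_lt hst.1) (not_not.1 hs)

end SkorokhodSpace

/-! ### Convergence in distribution -/

theorem edist_le_mul_min_one_edist {E F : Type*} [PseudoEMetricSpace E] [PseudoMetricSpace F]
    {f : E → F} {C : ℝ} {K : ℝ≥0} (hC : ∀ u v, dist (f u) (f v) ≤ C) (hK : LipschitzWith K f)
    (u v : E) : edist (f u) (f v) ≤ (max C.toNNReal K : ℝ≥0) * min 1 (edist u v) := by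
  rw [mul_min, mul_one]
  refine le_min ?_ ((hK u v).trans (by gcongr; exact le_max_right _ _))
  rw [edist_dist]
  exact (ENNReal.ofReal_le_ofReal (hC u v)).trans (ENNReal.coe_le_coe.2 (le_max_left _ _))

theorem edist_integral_comp_le {Ω E : Type*} [MeasurableSpace Ω] {P : Measure Ω}
    [IsProbabilityMeasure P] [PseudoEMetricSpace E] [MeasurableSpace E] [OpensMeasurableSpace E]
    {f : E → ℝ} (hf : Continuous f) {B : ℝ} (hB : ∀ u, ‖f u‖ ≤ B) {R : ℝ≥0}
    (hR : ∀ u v, edist (f u) (f v) ≤ R * min 1 (edist u v)) {X X' : Ω → E} (hX : AEMeasurable X P)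
    (hX' : AEMeasurable X' P) :
    edist (∫ ω, f (X ω) ∂P) (∫ ω, f (X' ω) ∂P) ≤ R * ∫⁻ ω, min 1 (edist (X ω) (X' ω)) ∂P := by
  have hint {W : Ω → E} (hW : AEMeasurable W P) : Integrable (fun ω => f (W ω)) P :=
    .of_bound (hf.measurable.comp_aemeasurable hW).aestronglyMeasurable B
      (ae_of_all _ fun _ => hB _)
  rw [edist_eq_enorm_sub, ← integral_sub (hint hX) (hint hX'),
    ← lintegral_const_mul' _ _ ENNReal.coe_ne_top]
  refine (enorm_integral_le_lintegral_enorm _).trans (lintegral_mono fun ω => ?_)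
  rw [← edist_eq_enorm_sub]
  exact hR _ _

section Approximation

variable {ι E Ω' : Type*} {Ω : ι → Type*} {l : Filter ι} [∀ n, MeasurableSpace (Ω n)]
  [MeasurableSpace Ω'] {P : (n : ι) → Measure (Ω n)} [∀ n, IsProbabilityMeasure (P n)]
  {P' : Measure Ω'} [IsProbabilityMeasure P'] [MeasurableSpace E]

theorem tendsto_integral_comp_of_tendstoInDistribution [TopologicalSpace E]
    [OpensMeasurableSpace E] {X : (n : ι) → Ω n → E} {Z : Ω' → E}
    (h : TendstoInDistribution X l Z P P') {f : E → ℝ} (hf : Continuous f) {B : ℝ}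
    (hB : ∀ u, ‖f u‖ ≤ B) :
    Tendsto (fun n => ∫ ω, f (X n ω) ∂P n) l (𝓝 (∫ ω, f (Z ω) ∂P')) := by
  have h' := ProbabilityMeasure.tendsto_iff_forall_integral_tendsto.1 h.tendsto
    (.ofNormedAddCommGroup f hf B hB)
  simp only [ProbabilityMeasure.coe_mk, BoundedContinuousFunction.coe_ofNormedAddCommGroup] at h'
  simp_rw [integral_map (h.forall_aemeasurable _) hf.measurable.aestronglyMeasurable] at h'
  rwa [integral_map h.aemeasurable_limit hf.measurable.aestronglyMeasurable] at h'

theorem tendsto_lintegral_comp_of_tendstoInDistribution [TopologicalSpace E]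
    [OpensMeasurableSpace E] {X : (n : ι) → Ω n → E} {Z : Ω' → E}
    (h : TendstoInDistribution X l Z P P') (f : BoundedContinuousFunction E ℝ≥0) :
    Tendsto (fun n => ∫⁻ ω, f (X n ω) ∂P n) l (𝓝 (∫⁻ ω, f (Z ω) ∂P')) := by
  have h' := ProbabilityMeasure.tendsto_iff_forall_lintegral_tendsto.1 h.tendsto f
  have hf : Measurable fun x => (f x : ℝ≥0∞) := f.continuous.measurable.coe_nnreal_ennreal
  simp only [ProbabilityMeasure.coe_mk] at h'
  simp_rw [lintegral_map' hf.aemeasurable (h.forall_aemeasurable _)] at h'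
  rwa [lintegral_map' hf.aemeasurable h.aemeasurable_limit] at h'

theorem tendsto_lintegral_min_one_edist_of_tendstoInDistribution [TopologicalSpace E]
    [OpensMeasurableSpace E] {F : Type*} [PseudoMetricSpace F] {X : (n : ι) → Ω n → E} {Z : Ω' → E}
    (h : TendstoInDistribution X l Z P P') {f g : E → F} (hf : Continuous f) (hg : Continuous g) :
    Tendsto (fun n => ∫⁻ ω, min 1 (edist (f (X n ω)) (g (X n ω))) ∂P n) l
      (𝓝 (∫⁻ ω, min 1 (edist (f (Z ω)) (g (Z ω))) ∂P')) := by
  let d : BoundedContinuousFunction E ℝ≥0 := .mkOfBound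
    ⟨fun x => min 1 (nndist (f x) (g x)), continuous_const.min (hf.nndist hg)⟩ 1
    fun x y => (NNReal.dist_eq _ _).trans_le (abs_sub_le_of_nonneg_of_le (by simp) (by simp)
      (by simp) (by simp))
  have h_coe (x : E) : (d x : ℝ≥0∞) = min 1 (edist (f x) (g x)) := by
    rw [edist_nndist]
    exact ENNReal.coe_min _ _
  simpa only [h_coe] using tendsto_lintegral_comp_of_tendstoInDistribution h d

theorem exists_measure_setOf_ge_lt {α : Type*} [MeasurableSpace α] {μ : Measure α}
    [IsFiniteMeasure μ] {Z : α → ℝ} (hZ : AEMeasurable Z μ) {ε : ℝ≥0∞} (hε : 0 < ε) :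
    ∃ K : ℝ, μ {ω | K ≤ Z ω} < ε := by
  have h := tendsto_measure_iInter_atTop (μ := μ) (s := fun K : ℝ => {ω | K ≤ Z ω})
    (fun K => hZ.nullMeasurableSet_preimage measurableSet_Ici)
    (fun _ _ hKK' ω hω => hKK'.trans hω) ⟨0, measure_ne_top _ _⟩
  have h_empty : ⋂ K : ℝ, {ω | K ≤ Z ω} = ∅ :=
    eq_empty_of_forall_notMem fun ω hω => (lt_add_one (Z ω)).not_ge (mem_iInter.1 hω (Z ω + 1))
  rw [h_empty, measure_empty] at h
  exact (h.eventually_lt_const hε).exists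

theorem eventually_measure_le_of_tendstoInDistribution {X : (n : ι) → Ω n → ℝ}
    {Z : Ω' → ℝ} (h : TendstoInDistribution X l Z P P') {ε : ℝ≥0∞} (hε : 0 < ε) :
    ∃ K : ℝ, P' {ω | K ≤ Z ω} ≤ ε ∧ ∀ᶠ n in l, P n {ω | K ≤ X n ω} ≤ ε := by
  obtain ⟨K, hK⟩ := exists_measure_setOf_ge_lt h.aemeasurable_limit hε
  have hlim := ProbabilityMeasure.limsup_measure_closed_le_of_tendsto h.tendsto
    (isClosed_Ici (a := K))
  simp only [ProbabilityMeasure.coe_mk] at hlim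
  simp_rw [Measure.map_apply_of_aemeasurable (h.forall_aemeasurable _) measurableSet_Ici] at hlim
  rw [Measure.map_apply_of_aemeasurable h.aemeasurable_limit measurableSet_Ici] at hlim
  exact ⟨K, hK.le, (eventually_lt_of_limsup_lt (hlim.trans_lt hK)).mono fun _ hn => hn.le⟩

theorem tendstoInDistribution_of_forall_approx [PseudoEMetricSpace E] [OpensMeasurableSpace E]
    [l.IsCountablyGenerated] {X : (n : ι) → Ω n → E} {Z : Ω' → E}
    (hX : ∀ n, AEMeasurable (X n) (P n)) (hZ : AEMeasurable Z P')
    (h : ∀ ε : ℝ≥0∞, 0 < ε → ∃ (V : (n : ι) → Ω n → E) (W : Ω' → E),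
      TendstoInDistribution V l W P P' ∧
      (∀ᶠ n in l, ∫⁻ ω, min 1 (edist (X n ω) (V n ω)) ∂P n ≤ ε) ∧
      ∫⁻ ω, min 1 (edist (Z ω) (W ω)) ∂P' ≤ ε) :
    TendstoInDistribution X l Z P P' := by
  refine ⟨hX, hZ, tendsto_iff_forall_lipschitz_integral_tendsto.2 ?_⟩
  rintro f ⟨C, hC⟩ ⟨K, hK⟩
  have hf : Continuous f := hK.continuous
  simp only [ProbabilityMeasure.coe_mk]
  simp_rw [integral_map (hX _) hf.aestronglyMeasurable]
  rw [integral_map hZ hf.aestronglyMeasurable]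
  obtain ⟨ω₀⟩ := nonempty_of_isProbabilityMeasure P'
  have hB (u : E) : ‖f u‖ ≤ ‖f (Z ω₀)‖ + C := by
    have := (norm_sub_norm_le (f u) (f (Z ω₀))).trans ((dist_eq_norm _ _).symm.trans_le (hC _ _))
    linarith
  set R : ℝ≥0 := max C.toNNReal K
  have hR : ∀ u v, edist (f u) (f v) ≤ R * min 1 (edist u v) := edist_le_mul_min_one_edist hC hK
  rw [tendsto_iff_edist_tendsto_0, ENNReal.tendsto_nhds_zero]
  intro ε hε
  have hε3 : 0 < ε / 3 := ENNReal.div_pos hε.ne' (by simp)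
  obtain ⟨η, hη, hRη⟩ : ∃ η : ℝ≥0∞, 0 < η ∧ R * η ≤ ε / 3 :=
    ⟨ε / 3 / R, ENNReal.div_pos hε3.ne' ENNReal.coe_ne_top, ENNReal.mul_div_le⟩
  obtain ⟨V, W, hVW, hXV, hZW⟩ := h η hη
  have hlim := tendsto_integral_comp_of_tendstoInDistribution hVW hf hB
  rw [tendsto_iff_edist_tendsto_0, ENNReal.tendsto_nhds_zero] at hlim
  filter_upwards [hXV, hlim _ hε3] with n hn hn'
  calc edist (∫ ω, f (X n ω) ∂P n) (∫ ω, f (Z ω) ∂P')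
      ≤ edist (∫ ω, f (X n ω) ∂P n) (∫ ω, f (V n ω) ∂P n) +
          edist (∫ ω, f (V n ω) ∂P n) (∫ ω, f (W ω) ∂P') +
          edist (∫ ω, f (Z ω) ∂P') (∫ ω, f (W ω) ∂P') := by
        rw [edist_comm (∫ ω, f (Z ω) ∂P')]
        exact edist_triangle4 _ _ _ _
    _ ≤ R * η + ε / 3 + R * η := by
        gcongr
        · exact (edist_integral_comp_le hf hB hR (hX n) (hVW.forall_aemeasurable n)).trans
            (by gcongr)
        · exact (edist_integral_comp_le hf hB hR hZ hVW.aemeasurable_limit).trans (by gcongr)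
    _ ≤ ε := (add_le_add (add_le_add hRη le_rfl) hRη).trans (ENNReal.add_thirds ε).le

end Approximation

/-! ### Measurability of `L^p`-valued maps -/

theorem measurable_of_measurable_edist {Ω E : Type*} [MeasurableSpace Ω] [PseudoEMetricSpace E]
    [SecondCountableTopology E] [MeasurableSpace E] [BorelSpace E] {f : Ω → E}
    (h : ∀ g : E, Measurable fun ω => edist (f ω) g) : Measurable f := by
  refine measurable_of_isOpen fun U hU => ?_
  choose! r hr hrU using fun x (hx : x ∈ U) => EMetric.isOpen_iff.1 hU x hx
  obtain ⟨T, -, hT, hcover⟩ := TopologicalSpace.isOpen_biUnion_countable U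
    (fun x => Metric.eball x (r x)) fun _ _ => Metric.isOpen_eball
  have hU_eq : U = ⋃ x ∈ T, Metric.eball x (r x) := by
    rw [hcover]
    exact (subset_antisymm (iUnion₂_subset hrU) fun x hx =>
      mem_biUnion hx (Metric.mem_eball_self (hr x hx))).symm
  rw [hU_eq, preimage_iUnion₂]
  exact .biUnion hT fun x _ => measurableSet_lt (h x) measurable_const

section Lp

variable {α Ω E : Type*} [MeasurableSpace α] [MeasurableSpace Ω] [NormedAddCommGroup E]
  {p : ℝ≥0∞} {μ : Measure α}

section Measurable

variable [MeasurableSpace E] [OpensMeasurableSpace E] [SFinite μ]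

theorem measurable_eLpNorm_prod {f : α × Ω → E} (hf : Measurable f) (hp0 : p ≠ 0) (hp : p ≠ ∞) :
    Measurable fun ω => eLpNorm (fun x => f (x, ω)) p μ := by
  simp only [eLpNorm_eq_lintegral_rpow_enorm_toReal hp0 hp]
  exact (Measurable.lintegral_prod_left' (hf.enorm.pow_const p.toReal)).pow_const _

theorem lintegral_eLpNorm_le {P : Measure Ω} [IsProbabilityMeasure P] {f : α × Ω → E}
    (hf : Measurable f) (hp1 : 1 ≤ p) (hp : p ≠ ∞) :
    ∫⁻ ω, eLpNorm (fun x => f (x, ω)) p μ ∂P ≤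
      (∫⁻ x, ∫⁻ ω, ‖f (x, ω)‖ₑ ^ p.toReal ∂P ∂μ) ^ (1 / p.toReal) := by
  have hp0 : p ≠ 0 := (one_pos.trans_le hp1).ne'
  have hjensen := eLpNorm_le_eLpNorm_of_exponent_le (μ := P) hp1
    (measurable_eLpNorm_prod (μ := μ) hf hp0 hp).aestronglyMeasurable
  rw [eLpNorm_one_eq_lintegral_enorm, eLpNorm_eq_lintegral_rpow_enorm_toReal hp0 hp] at hjensen
  refine hjensen.trans_eq ?_
  simp only [enorm_eq_self, eLpNorm_eq_lintegral_rpow_enorm_toReal hp0 hp, one_div,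
    ENNReal.rpow_inv_rpow (ENNReal.toReal_pos hp0 hp).ne']
  rw [lintegral_lintegral_swap (f := fun x ω => ‖f (x, ω)‖ₑ ^ p.toReal)
    (hf.enorm.pow_const _).aemeasurable]

end Measurable

open Classical in
/-- The class of `f` in `L^p`, with the value `0` if `f` is not in `L^p`. -/
noncomputable def toLpOrZero (p : ℝ≥0∞) (μ : Measure α) (f : α → E) : Lp E p μ :=
  if h : MemLp f p μ then h.toLp f else 0

theorem coeFn_toLpOrZero {f : α → E} (hf : MemLp f p μ) : toLpOrZero p μ f =ᵐ[μ] f := by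
  rw [toLpOrZero, dif_pos hf]
  exact hf.coeFn_toLp

theorem measurable_toLpOrZero [MeasurableSpace E] [BorelSpace E] [SecondCountableTopology E]
    [SFinite μ] [Fact (1 ≤ p)] [SecondCountableTopology (Lp E p μ)] [MeasurableSpace (Lp E p μ)]
    [BorelSpace (Lp E p μ)] (hp : p ≠ ∞) {f : α × Ω → E} (hf : Measurable f) :
    Measurable fun ω => toLpOrZero p μ fun x => f (x, ω) := by
  have hp0 : p ≠ 0 := (one_pos.trans_le (Fact.out (p := 1 ≤ p))).ne'
  have hmem (ω : Ω) : MemLp (fun x => f (x, ω)) p μ ↔ eLpNorm (fun x => f (x, ω)) p μ < ∞ :=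
    ⟨fun h => h.2, fun h => ⟨(hf.comp measurable_prodMk_right).aestronglyMeasurable, h⟩⟩
  refine measurable_of_measurable_edist fun g => ?_
  have hg : Measurable g := (Lp.stronglyMeasurable g).measurable
  classical
  let A : Set Ω := {ω | eLpNorm (fun x => f (x, ω)) p μ < ∞}
  have hA : MeasurableSet A := measurableSet_lt (measurable_eLpNorm_prod hf hp0 hp) measurable_const
  have hedist : (fun ω => edist (toLpOrZero p μ fun x => f (x, ω)) g) = A.piecewise
      (fun ω => eLpNorm (fun x => f (x, ω) - g x) p μ) fun _ => edist 0 g := by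
    ext ω
    by_cases hω : ω ∈ A
    · rw [piecewise_eq_of_mem A _ _ hω, Lp.edist_def]
      refine eLpNorm_congr_ae ?_
      filter_upwards [coeFn_toLpOrZero ((hmem ω).2 hω)] with x hx
      rw [Pi.sub_apply, hx]
    · rw [piecewise_eq_of_notMem A _ _ hω, toLpOrZero, dif_neg (mt (hmem ω).1 hω)]
  rw [hedist]
  exact (measurable_eLpNorm_prod (hf.sub (hg.comp measurable_fst)) hp0 hp).piecewise hA
    measurable_const

end Lp

/-! ### Averages over the cells of a grid -/

/-- A continuous probability density supported in `[0, 1]`. -/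
noncomputable def bump : ℝ → ℝ :=
  ContDiffBump.normed (c := (1 / 2 : ℝ)) ⟨1 / 4, 1 / 2, by norm_num, by norm_num⟩ volume

theorem continuous_bump : Continuous bump := ContDiffBump.continuous_normed _

theorem bump_nonneg (u : ℝ) : 0 ≤ bump u := ContDiffBump.nonneg_normed _ u

theorem integral_bump : ∫ u, bump u = 1 := ContDiffBump.integral_normed _

theorem support_bump : Function.support bump = Ioo 0 1 := by
  rw [bump, ContDiffBump.support_normed_eq, Real.ball_eq_Ioo]
  norm_num

theorem bump_le_two (u : ℝ) : bump u ≤ 2 := by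
  refine (ContDiffBump.normed_le_div_measure_closedBall_rIn _ _ u).trans_eq ?_
  rw [Real.volume_real_closedBall (by norm_num)]
  norm_num

/-- The cell `[jδ, (j+1)δ)` of the grid of mesh `δ`. -/
def cell (δ : ℝ) (j : ℤ) : Set ℝ := {x | ⌊δ⁻¹ * x⌋ = j}

theorem mem_cell {δ : ℝ} {j : ℤ} {x : ℝ} : x ∈ cell δ j ↔ ⌊δ⁻¹ * x⌋ = j := Iff.rfl

theorem measurable_floor_mul (c : ℝ) : Measurable fun x : ℝ => ⌊c * x⌋ :=
  Int.measurable_floor.comp (measurable_const_mul c)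

theorem measurableSet_cell (δ : ℝ) (j : ℤ) : MeasurableSet (cell δ j) :=
  measurable_floor_mul δ⁻¹ (measurableSet_singleton j)

theorem pairwiseDisjoint_cell (s : Set ℤ) (δ : ℝ) : s.PairwiseDisjoint (cell δ) := by
  intro i _ j _ hij
  refine Set.disjoint_left.2 fun x hi hj => hij ?_
  rw [← mem_cell.1 hi, mem_cell.1 hj]

theorem cell_eq_Ico {δ : ℝ} (hδ : 0 < δ) (j : ℤ) : cell δ j = Ico (δ * j) (δ * (j + 1)) := by
  ext x
  rw [mem_cell, Int.floor_eq_iff, le_inv_mul_iff₀ hδ, inv_mul_lt_iff₀ hδ, mem_Ico]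

theorem volume_cell {δ : ℝ} (hδ : δ ≠ 0) (j : ℤ) :
    volume (cell δ j) = ENNReal.ofReal |δ| := by
  have h_preimage : cell δ j = (δ⁻¹ * ·) ⁻¹' Ico (j : ℝ) (j + 1) := by
    ext x
    exact Int.floor_eq_iff
  rw [h_preimage, Real.volume_preimage_mul_left (inv_ne_zero hδ), inv_inv, Real.volume_Ico,
    add_sub_cancel_left, ENNReal.ofReal_one, mul_one]

theorem volume_cell_ne_top {δ : ℝ} (hδ : δ ≠ 0) (j : ℤ) : volume (cell δ j) ≠ ∞ := by
  rw [volume_cell hδ]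
  exact ENNReal.ofReal_ne_top

theorem volume_real_cell {δ : ℝ} (hδ : 0 < δ) (j : ℤ) : volume.real (cell δ j) = δ := by
  rw [measureReal_def, volume_cell hδ.ne', abs_of_pos hδ, ENNReal.toReal_ofReal hδ.le]

theorem cell_subset_closedBall {δ : ℝ} (hδ : 0 < δ) {j : ℤ} {x : ℝ} (hx : x ∈ cell δ j) :
    cell δ j ⊆ Metric.closedBall x δ := by
  rw [cell_eq_Ico hδ] at hx ⊢
  intro y hy
  rw [Metric.mem_closedBall, Real.dist_eq, abs_le]
  constructor <;> linarith [hx.1, hx.2, hy.1, hy.2]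

/-- A continuous probability density supported in the cell `[jδ, (j+1)δ)`. -/
noncomputable def cellKernel (δ : ℝ) (j : ℤ) (x : ℝ) : ℝ := δ⁻¹ * bump (δ⁻¹ * x - j)

theorem continuous_cellKernel (δ : ℝ) (j : ℤ) : Continuous (cellKernel δ j) :=
  continuous_const.mul (continuous_bump.comp (by fun_prop))

theorem abs_cellKernel_le {δ : ℝ} (hδ : 0 < δ) (j : ℤ) (x : ℝ) :
    |cellKernel δ j x| ≤ 2 * δ⁻¹ := by
  have h0 := inv_pos.2 hδ
  rw [cellKernel, abs_of_nonneg (mul_nonneg h0.le (bump_nonneg _)), mul_comm]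
  exact mul_le_mul_of_nonneg_right (bump_le_two _) h0.le

theorem support_cellKernel_subset (δ : ℝ) (j : ℤ) :
    Function.support (cellKernel δ j) ⊆ cell δ j := by
  intro x hx
  have h : δ⁻¹ * x - j ∈ Function.support bump := right_ne_zero_of_mul hx
  rw [support_bump] at h
  exact Int.floor_eq_iff.2 ⟨by linarith [h.1], by linarith [h.2]⟩

theorem hasCompactSupport_cellKernel {δ : ℝ} (hδ : 0 < δ) (j : ℤ) :
    HasCompactSupport (cellKernel δ j) :=
  .of_support_subset_isCompact isCompact_Icc
    ((support_cellKernel_subset δ j).trans ((cell_eq_Ico hδ j).trans_subset Ico_subset_Icc_self))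

theorem uniformContinuous_cellKernel {δ : ℝ} (hδ : 0 < δ) (j : ℤ) :
    UniformContinuous (cellKernel δ j) :=
  (hasCompactSupport_cellKernel hδ j).uniformContinuous_of_continuous (continuous_cellKernel δ j)

theorem integrable_cellKernel {δ : ℝ} (hδ : 0 < δ) (j : ℤ) : Integrable (cellKernel δ j) :=
  (continuous_cellKernel δ j).integrable_of_hasCompactSupport (hasCompactSupport_cellKernel hδ j)

theorem integral_cellKernel {δ : ℝ} (hδ : 0 < δ) (j : ℤ) : ∫ x, cellKernel δ j x = 1 := by
  simp only [cellKernel]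
  rw [integral_const_mul, Measure.integral_comp_mul_left (fun u => bump (u - j)),
    integral_sub_right_eq_self bump, integral_bump, inv_inv, abs_of_pos hδ, smul_eq_mul, mul_one,
    inv_mul_cancel₀ hδ.ne']

theorem integrable_cellKernel_mul {δ : ℝ} (hδ : 0 < δ) (j : ℤ) {f : ℝ → ℝ}
    (hf : Integrable f) : Integrable fun y => cellKernel δ j y * f y :=
  hf.bdd_mul (c := 2 * δ⁻¹) (continuous_cellKernel δ j).aestronglyMeasurable
    (ae_of_all _ fun x => abs_cellKernel_le hδ j x)

theorem abs_integral_cellKernel_mul_sub_le {δ : ℝ} (hδ : 0 < δ) (j : ℤ) {f : ℝ → ℝ}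
    (hf : Integrable f) (c : ℝ) :
    |(∫ y, cellKernel δ j y * f y) - c| ≤ 2 * ⨍ y in cell δ j, |f y - c| := by
  have h_center : (∫ y, cellKernel δ j y * f y) - c = ∫ y, cellKernel δ j y * (f y - c) := by
    simp only [mul_sub]
    rw [integral_sub (integrable_cellKernel_mul hδ j hf) ((integrable_cellKernel hδ j).mul_const c),
      integral_mul_const, integral_cellKernel hδ, one_mul]
  have h_local : ∫ y, cellKernel δ j y * (f y - c) =
      ∫ y in cell δ j, cellKernel δ j y * (f y - c) :=
    (setIntegral_eq_integral_of_forall_compl_eq_zero fun y hy => by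
      rw [Function.notMem_support.1 (mt (support_cellKernel_subset δ j ·) hy), zero_mul]).symm
  have hint : IntegrableOn (fun y => |f y - c|) (cell δ j) :=
    (hf.integrableOn.sub (integrableOn_const (volume_cell_ne_top hδ.ne' j))).abs
  rw [h_center, h_local, setAverage_eq, volume_real_cell hδ, smul_eq_mul, ← mul_assoc,
    ← integral_const_mul, ← Real.norm_eq_abs]
  refine norm_integral_le_of_norm_le (hint.const_mul _) (ae_of_all _ fun y => ?_)
  rw [norm_mul]
  exact mul_le_mul_of_nonneg_right (abs_cellKernel_le hδ j y) (abs_nonneg _)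

/-- The function that is constant on each cell, with value a weighted average of `f` there. -/
noncomputable def cellAverage (δ : ℝ) (f : ℝ → ℝ) (x : ℝ) : ℝ :=
  ∫ y, cellKernel δ ⌊δ⁻¹ * x⌋ y * f y

theorem measurable_cellAverage (δ : ℝ) (f : ℝ → ℝ) : Measurable (cellAverage δ f) :=
  (measurable_of_countable fun j : ℤ => ∫ y, cellKernel δ j y * f y).comp
    (measurable_floor_mul δ⁻¹)

theorem measurable_gridFloor (δ : ℝ) : Measurable (gridFloor δ) :=
  (measurable_of_countable fun j : ℤ => δ * (j : ℝ)).comp (measurable_floor_mul δ⁻¹)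

theorem eLpNorm_average_le {α : Type*} [MeasurableSpace α] {μ : Measure α} [IsFiniteMeasure μ]
    (g : α → ℝ) {p : ℝ≥0∞} (hp1 : 1 ≤ p) : eLpNorm (fun _ => ⨍ y, g y ∂μ) p μ ≤ eLpNorm g p μ := by
  have h := eLpNorm_condExp_le_eLpNorm (m := ⊥) (μ := μ) g hp1
  rcases eq_zero_or_neZero μ with rfl | hμ
  · simp only [eLpNorm_measure_zero, le_refl]
  · simpa only [condExp_bot', ← average_eq] using h

theorem eLpNorm_cellAverage_sub_cell_le {δ : ℝ} (hδ : 0 < δ) (j : ℤ) {f : ℝ → ℝ}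
    (hf : Integrable f) {p : ℝ≥0∞} (hp1 : 1 ≤ p) :
    eLpNorm (fun x => cellAverage δ f x - f (gridFloor δ x)) p (volume.restrict (cell δ j)) ≤
      2 * eLpNorm (fun x => f x - f (gridFloor δ x)) p (volume.restrict (cell δ j)) := by
  set μ := volume.restrict (cell δ j)
  set c := f (δ * j)
  have hfin : IsFiniteMeasure μ := isFiniteMeasure_restrict.2 (volume_cell_ne_top hδ.ne' j)
  have h_cell : ∀ᵐ x ∂μ, ⌊δ⁻¹ * x⌋ = j := ae_restrict_mem (measurableSet_cell δ j)
  calc eLpNorm (fun x => cellAverage δ f x - f (gridFloor δ x)) p μ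
      ≤ eLpNorm (fun _ => (2 : ℝ) * ⨍ y, |f y - c| ∂μ) p μ := by
        refine eLpNorm_mono_ae ?_
        filter_upwards [h_cell] with x hx
        rw [gridFloor, cellAverage, hx]
        exact (abs_integral_cellKernel_mul_sub_le hδ j hf c).trans (le_abs_self _)
    _ = 2 * eLpNorm (fun _ => ⨍ y, |f y - c| ∂μ) p μ := by
        rw [show (fun _ : ℝ => (2 : ℝ) * ⨍ y, |f y - c| ∂μ) =
          (2 : ℝ) • fun _ => ⨍ y, |f y - c| ∂μ from rfl, eLpNorm_const_smul,
          Real.enorm_of_nonneg zero_le_two, ENNReal.ofReal_ofNat]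
    _ ≤ 2 * eLpNorm (fun y => |f y - c|) p μ := by gcongr; exact eLpNorm_average_le _ hp1
    _ = 2 * eLpNorm (fun x => f x - f (gridFloor δ x)) p μ := by
        congr 1
        refine eLpNorm_congr_norm_ae ?_
        filter_upwards [h_cell] with x hx
        rw [Real.norm_eq_abs, abs_abs, gridFloor, hx, Real.norm_eq_abs]

theorem eLpNorm_biUnion_le {α ι E F : Type*} [MeasurableSpace α] {μ : Measure α}
    [NormedAddCommGroup E] [NormedAddCommGroup F] {p : ℝ≥0∞} (hp0 : p ≠ 0) (hp : p ≠ ∞)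
    {f : α → E} {g : α → F} {K : ℝ≥0∞} {T : Finset ι} {s : ι → Set α}
    (hd : Set.PairwiseDisjoint (T : Set ι) s) (hs : ∀ i ∈ T, MeasurableSet (s i))
    (h : ∀ i ∈ T, eLpNorm f p (μ.restrict (s i)) ≤ K * eLpNorm g p (μ.restrict (s i))) :
    eLpNorm f p (μ.restrict (⋃ i ∈ T, s i)) ≤ K * eLpNorm g p (μ.restrict (⋃ i ∈ T, s i)) := by
  have hp' : 0 < p.toReal := ENNReal.toReal_pos hp0 hp
  rw [← ENNReal.rpow_le_rpow_iff hp', ENNReal.mul_rpow_of_nonneg _ _ hp'.le]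
  simp only [eLpNorm_eq_lintegral_rpow_enorm_toReal hp0 hp, one_div, ENNReal.rpow_inv_rpow hp'.ne']
    at h ⊢
  rw [lintegral_biUnion_finset hd hs, lintegral_biUnion_finset hd hs, Finset.mul_sum]
  refine Finset.sum_le_sum fun i hi => ?_
  have := ENNReal.rpow_le_rpow (h i hi) hp'.le
  rwa [ENNReal.mul_rpow_of_nonneg _ _ hp'.le, ENNReal.rpow_inv_rpow hp'.ne',
    ENNReal.rpow_inv_rpow hp'.ne'] at this

/-- The mesh of the `J`-th grid; its inverse is an integer, so that the window `[-M, M)` is a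
union of cells. -/
noncomputable def mesh (J : ℕ) : ℝ := ((J : ℝ) + 1)⁻¹

theorem mesh_pos (J : ℕ) : 0 < mesh J := by unfold mesh; positivity

theorem tendsto_mesh : Tendsto mesh atTop (𝓝[>] 0) := by
  refine tendsto_nhdsWithin_iff.2 ⟨?_, Eventually.of_forall mesh_pos⟩
  unfold mesh
  simpa only [one_div] using tendsto_one_div_add_atTop_nhds_zero_nat (𝕜 := ℝ)

/-- The window `[-M, M)` to which local times are restricted before they are approximated. -/
def window (M : ℕ) : Set ℝ := Ico (-(M : ℝ)) M

theorem measurableSet_window (M : ℕ) : MeasurableSet (window M) := measurableSet_Ico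

instance isFiniteMeasure_restrict_window (M : ℕ) : IsFiniteMeasure (volume.restrict (window M)) :=
  inferInstanceAs (IsFiniteMeasure (volume.restrict (Ico _ _)))

/-- The indices of the cells of mesh `1 / (J + 1)` that make up `[-M, M)`. -/
noncomputable def cellIndices (M J : ℕ) : Finset ℤ :=
  Finset.Ico (-((M : ℤ) * (J + 1))) (M * (J + 1))

theorem floor_mem_cellIndices {M J : ℕ} {x : ℝ} :
    ⌊(mesh J)⁻¹ * x⌋ ∈ cellIndices M J ↔ x ∈ window M := by
  have hJ : (0 : ℝ) < (J : ℝ) + 1 := by positivity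
  rw [cellIndices, Finset.mem_Ico, Int.le_floor, Int.floor_lt, mesh, inv_inv, window, mem_Ico]
  push_cast
  rw [← neg_mul, mul_comm (-(M : ℝ)), mul_comm (M : ℝ), mul_le_mul_iff_right₀ hJ,
    mul_lt_mul_iff_right₀ hJ]

theorem biUnion_cell (M J : ℕ) : ⋃ j ∈ cellIndices M J, cell (mesh J) j = window M := by
  ext x
  simp only [mem_iUnion, mem_cell, exists_prop, exists_eq_right', floor_mem_cellIndices]

theorem eLpNorm_sub_cellAverage_le (M J : ℕ) {f : ℝ → ℝ} (hf : Integrable f) (hfm : Measurable f)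
    {p : ℝ≥0∞} (hp1 : 1 ≤ p) (hp : p ≠ ∞) :
    eLpNorm (fun x => f x - cellAverage (mesh J) f x) p (volume.restrict (window M)) ≤
      3 * eLpNorm (fun x => f x - f (gridFloor (mesh J) x)) p (volume.restrict (window M)) := by
  have hg : Measurable fun x => f (gridFloor (mesh J) x) := hfm.comp (measurable_gridFloor _)
  have h_average : eLpNorm (fun x => cellAverage (mesh J) f x - f (gridFloor (mesh J) x)) p
      (volume.restrict (window M)) ≤
      2 * eLpNorm (fun x => f x - f (gridFloor (mesh J) x)) p (volume.restrict (window M)) := by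
    rw [← biUnion_cell M J]
    exact eLpNorm_biUnion_le (one_pos.trans_le hp1).ne' hp (pairwiseDisjoint_cell _ _)
      (fun j _ => measurableSet_cell _ _)
      fun j _ => eLpNorm_cellAverage_sub_cell_le (mesh_pos J) j hf hp1
  calc eLpNorm (fun x => f x - cellAverage (mesh J) f x) p (volume.restrict (window M))
      = eLpNorm ((fun x => f x - f (gridFloor (mesh J) x)) -
          fun x => cellAverage (mesh J) f x - f (gridFloor (mesh J) x)) p
          (volume.restrict (window M)) := by
        congr 1
        ext x
        exact (sub_sub_sub_cancel_right _ _ _).symm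
    _ ≤ _ := eLpNorm_sub_le (hfm.sub hg).aestronglyMeasurable
        ((measurable_cellAverage _ f).sub hg).aestronglyMeasurable hp1
    _ ≤ _ := add_le_add le_rfl h_average
    _ = _ := by ring

theorem ae_tendsto_cellAverage {f : ℝ → ℝ} (hf : Integrable f) :
    ∀ᵐ x, Tendsto (fun J => cellAverage (mesh J) f x) atTop (𝓝 (f x)) := by
  filter_upwards [IsUnifLocDoublingMeasure.ae_tendsto_average_norm_sub volume
    hf.locallyIntegrable 1] with x hx
  have h := hx (fun _ : ℕ => x) mesh tendsto_mesh (Eventually.of_forall fun J => by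
    rw [one_mul]; exact Metric.mem_closedBall_self (mesh_pos J).le)
  rw [tendsto_iff_dist_tendsto_zero]
  refine squeeze_zero (fun _ => dist_nonneg) (fun J => ?_)
    (by simpa only [mul_zero] using h.const_mul 4)
  have hδ := mesh_pos J
  have hint : IntegrableOn (fun y => |f y - f x|) (Metric.closedBall x (mesh J)) :=
    (hf.integrableOn.sub (integrableOn_const measure_closedBall_lt_top.ne)).abs
  calc dist (cellAverage (mesh J) f x) (f x)
      ≤ 2 * ⨍ y in cell (mesh J) ⌊(mesh J)⁻¹ * x⌋, |f y - f x| :=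
        abs_integral_cellKernel_mul_sub_le hδ _ hf (f x)
    _ = 2 * (mesh J)⁻¹ * ∫ y in cell (mesh J) ⌊(mesh J)⁻¹ * x⌋, |f y - f x| := by
        rw [setAverage_eq, volume_real_cell hδ, smul_eq_mul, mul_assoc]
    _ ≤ 2 * (mesh J)⁻¹ * ∫ y in Metric.closedBall x (mesh J), |f y - f x| := by
        refine mul_le_mul_of_nonneg_left ?_ (by positivity)
        exact setIntegral_mono_set hint (ae_of_all _ fun _ => abs_nonneg _)
          (cell_subset_closedBall hδ (mem_cell.2 rfl)).eventuallyLE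
    _ = 4 * ⨍ y in Metric.closedBall x (mesh J), ‖f y - f x‖ := by
        simp only [setAverage_eq, Real.volume_real_closedBall hδ.le, smul_eq_mul,
          Real.norm_eq_abs, mul_inv]
        ring

/-! ### Rescaled discrete local times -/

theorem rescaledLocalTime_eq_sum (a : ℝ) (n : ℕ) (s : ℕ → ℤ) (t : ℝ≥0) (x : ℝ) :
    rescaledLocalTime a n s t x = ∑ k ∈ Finset.range (⌊(n : ℝ≥0) * t⌋₊ + 1),
      (n : ℝ)⁻¹ * (a * (cell a⁻¹ (s k)).indicator 1 x) := by
  simp only [rescaledLocalTime, discreteLocalTime, Finset.card_filter]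
  push_cast
  rw [Finset.mul_sum]
  refine Finset.sum_congr rfl fun k _ => ?_
  have h_mem : x ∈ cell a⁻¹ (s k) ↔ s k = ⌊a * x⌋ := by rw [mem_cell, inv_inv, eq_comm]
  by_cases hx : x ∈ cell a⁻¹ (s k)
  · rw [indicator_of_mem hx, if_pos (h_mem.1 hx), Pi.one_apply, mul_assoc]
  · rw [indicator_of_notMem hx, if_neg (mt h_mem.2 hx), mul_zero, mul_zero, mul_zero]

theorem memLp_rescaledLocalTime (a : ℝ) (n : ℕ) (s : ℕ → ℤ) (t : ℝ≥0) (p : ℝ≥0∞) :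
    MemLp (rescaledLocalTime a n s t) p := by
  rw [funext (rescaledLocalTime_eq_sum a n s t)]
  refine memLp_finsetSum _ fun k _ => MemLp.const_mul ?_ _
  rcases eq_or_ne a 0 with rfl | ha
  · simp only [zero_mul, MemLp.zero']
  · exact (memLp_indicator_const p (measurableSet_cell _ _) (1 : ℝ)
      (Or.inr (volume_cell_ne_top (inv_ne_zero ha) _))).const_mul a

theorem integrable_rescaledLocalTime (a : ℝ) (n : ℕ) (s : ℕ → ℤ) (t : ℝ≥0) :
    Integrable (rescaledLocalTime a n s t) :=
  memLp_one_iff_integrable.1 (memLp_rescaledLocalTime a n s t 1)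

theorem measurable_rescaledLocalTime_prod {Ω : Type*} [MeasurableSpace Ω] {S : ℕ → Ω → ℤ}
    (hS : ∀ k, Measurable (S k)) (a : ℝ) (n : ℕ) (t : ℝ≥0) :
    Measurable fun z : ℝ × Ω => rescaledLocalTime a n (fun k => S k z.2) t z.1 := by
  simp only [rescaledLocalTime_eq_sum]
  refine Finset.measurable_fun_sum _ fun k _ => Measurable.const_mul (Measurable.const_mul ?_ a) _
  have h_set : MeasurableSet {z : ℝ × Ω | ⌊a⁻¹⁻¹ * z.1⌋ = S k z.2} := measurableSet_eq_fun
    ((measurable_floor_mul a⁻¹⁻¹).comp measurable_fst) ((hS k).comp measurable_snd)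
  exact (measurable_const (a := (1 : ℝ))).indicator h_set

theorem measurable_rescaledLocalTime (a : ℝ) (n : ℕ) (s : ℕ → ℤ) (t : ℝ≥0) :
    Measurable (rescaledLocalTime a n s t) := by
  rw [funext (rescaledLocalTime_eq_sum a n s t)]
  exact Finset.measurable_fun_sum _ fun k _ =>
    ((measurable_const.indicator (measurableSet_cell _ _)).const_mul a).const_mul _

theorem rescaledLocalTime_eq_zero {a : ℝ} (ha : 1 ≤ a) {n : ℕ} (hn : n ≠ 0) {s : ℕ → ℤ} {t : ℝ≥0}
    {K : ℝ} (h : ∀ r ≤ t, |rescaledPath a n s r| < K) {M : ℕ} (hM : K + 1 ≤ M) {x : ℝ}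
    (hx : x ∉ window M) : rescaledLocalTime a n s t x = 0 := by
  have ha0 : 0 < a := one_pos.trans_le ha
  have hn0 : (0 : ℝ≥0) < n := by exact_mod_cast Nat.pos_of_ne_zero hn
  rw [rescaledLocalTime_eq_sum]
  refine Finset.sum_eq_zero fun k hk => ?_
  rw [indicator_of_notMem, mul_zero, mul_zero]
  intro hxk
  refine hx ?_
  rw [cell_eq_Ico (inv_pos.2 ha0)] at hxk
  have hk' : (k : ℝ≥0) ≤ n * t := (Nat.le_floor_iff (by positivity)).1
    (Finset.mem_range_succ_iff.1 hk)
  have h_path := h ((k : ℝ≥0) / n) (by rwa [div_le_iff₀ hn0, mul_comm])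
  simp only [rescaledPath] at h_path
  rw [mul_div_cancel₀ _ hn0.ne', Nat.floor_natCast, abs_lt] at h_path
  have ha1 : a⁻¹ ≤ 1 := inv_le_one_of_one_le₀ ha
  constructor <;> linarith [hxk.1, hxk.2, h_path.1, h_path.2]

theorem integrableOn_cell {δ : ℝ} (hδ : 0 < δ) (j : ℤ) {ψ : ℝ → ℝ} (hψ : Continuous ψ) :
    IntegrableOn ψ (cell δ j) :=
  hψ.integrableOn_Icc.mono_set ((cell_eq_Ico hδ j).trans_subset Ico_subset_Icc_self)

theorem integral_mul_rescaledLocalTime {a : ℝ} (ha : 0 < a) (n : ℕ) (s : ℕ → ℤ) (t : ℝ≥0)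
    {ψ : ℝ → ℝ} (hψ : Continuous ψ) :
    ∫ x, ψ x * rescaledLocalTime a n s t x = ∑ k ∈ Finset.range (⌊(n : ℝ≥0) * t⌋₊ + 1),
      (n : ℝ)⁻¹ * ⨍ x in cell a⁻¹ (s k), ψ x := by
  have ha' := inv_pos.2 ha
  have hint (k : ℕ) : Integrable ((cell a⁻¹ (s k)).indicator ψ) :=
    (integrable_indicator_iff (measurableSet_cell _ _)).2 (integrableOn_cell ha' _ hψ)
  have h_mul (k : ℕ) (x : ℝ) : ψ x * ((n : ℝ)⁻¹ * (a * (cell a⁻¹ (s k)).indicator 1 x)) =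
      (n : ℝ)⁻¹ * (a * (cell a⁻¹ (s k)).indicator ψ x) := by
    by_cases hx : x ∈ cell a⁻¹ (s k)
    · rw [indicator_of_mem hx, indicator_of_mem hx, Pi.one_apply]
      ring
    · simp only [indicator_of_notMem hx, mul_zero]
  simp only [rescaledLocalTime_eq_sum, Finset.mul_sum, h_mul]
  rw [integral_finsetSum _ fun k _ => ((hint k).const_mul a).const_mul _]
  refine Finset.sum_congr rfl fun k _ => ?_
  rw [integral_const_mul, integral_const_mul, integral_indicator (measurableSet_cell _ _),
    setAverage_eq, volume_real_cell ha', inv_inv, smul_eq_mul]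

theorem abs_setAverage_cell_sub_le {δ η : ℝ} (hδ : 0 < δ) {ψ : ℝ → ℝ} (hψ : Continuous ψ)
    (hη : ∀ u v, |u - v| ≤ δ → |ψ u - ψ v| ≤ η) (j : ℤ) :
    |(⨍ x in cell δ j, ψ x) - ψ (δ * j)| ≤ η := by
  have hj : δ * j ∈ cell δ j := by rw [mem_cell, inv_mul_cancel_left₀ hδ.ne', Int.floor_intCast]
  have h_pos : volume (cell δ j) ≠ 0 := by
    rw [volume_cell hδ.ne', abs_of_pos hδ]
    exact (ENNReal.ofReal_pos.2 hδ).ne'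
  have h_mem := (convex_closedBall (ψ (δ * j)) η).set_average_mem Metric.isClosed_closedBall h_pos
    (volume_cell_ne_top hδ.ne' j)
    ((ae_restrict_mem (measurableSet_cell δ j)).mono fun x hx =>
      hη x _ (cell_subset_closedBall hδ hj hx))
    (integrableOn_cell hδ j hψ)
  exact h_mem

theorem abs_integral_mul_rescaledLocalTime_sub_sum_le {a η : ℝ} (ha : 0 < a) {n : ℕ} (hn : n ≠ 0)
    (s : ℕ → ℤ) (t : ℝ≥0) {ψ : ℝ → ℝ} (hψ : Continuous ψ)
    (hη : ∀ u v, |u - v| ≤ a⁻¹ → |ψ u - ψ v| ≤ η) :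
    |(∫ x, ψ x * rescaledLocalTime a n s t x) -
      ∑ k ∈ Finset.range (⌊(n : ℝ≥0) * t⌋₊ + 1), (n : ℝ)⁻¹ * ψ (a⁻¹ * s k)| ≤ (t + 1) * η := by
  have hn1 : (1 : ℝ) ≤ n := by exact_mod_cast Nat.one_le_iff_ne_zero.2 hn
  have hn0 : (0 : ℝ) < n := one_pos.trans_le hn1
  have hη0 : 0 ≤ η := (abs_nonneg _).trans (hη 0 0 (by simpa using ha.le))
  have hN : (⌊(n : ℝ≥0) * t⌋₊ : ℝ) ≤ n * t := by
    exact_mod_cast Nat.floor_le (a := (n : ℝ≥0) * t) zero_le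
  have h_term (k : ℕ) : |(n : ℝ)⁻¹ * (⨍ x in cell a⁻¹ (s k), ψ x) -
      (n : ℝ)⁻¹ * ψ (a⁻¹ * s k)| ≤ (n : ℝ)⁻¹ * η := by
    rw [← mul_sub, abs_mul, abs_of_pos (inv_pos.2 hn0)]
    exact mul_le_mul_of_nonneg_left (abs_setAverage_cell_sub_le (inv_pos.2 ha) hψ hη _)
      (inv_pos.2 hn0).le
  rw [integral_mul_rescaledLocalTime ha n s t hψ, ← Finset.sum_sub_distrib]
  refine (Finset.abs_sum_le_sum_abs _ _).trans ((Finset.sum_le_sum fun k _ => h_term k).trans ?_)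
  rw [Finset.sum_const, Finset.card_range, nsmul_eq_mul, ← mul_assoc]
  refine mul_le_mul_of_nonneg_right ?_ hη0
  rw [← div_eq_mul_inv, div_le_iff₀ hn0]
  push_cast
  nlinarith

theorem rescaledPath_toNNReal {a : ℝ} {n : ℕ} (hn : n ≠ 0) (s : ℕ → ℤ) {k : ℕ} {u : ℝ}
    (hu : u ∈ Ico ((k : ℝ) / n) ((k + 1 : ℕ) / n)) :
    rescaledPath a n s u.toNNReal = a⁻¹ * s k := by
  have hn0 : (0 : ℝ) < n := by exact_mod_cast Nat.pos_of_ne_zero hn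
  have hu0 : 0 ≤ u := (by positivity : (0 : ℝ) ≤ k / n).trans hu.1
  rw [mem_Ico, div_le_iff₀ hn0, lt_div_iff₀ hn0] at hu
  have h_floor : ⌊(n : ℝ≥0) * u.toNNReal⌋₊ = k := by
    rw [Nat.floor_eq_iff zero_le, ← NNReal.coe_le_coe, ← NNReal.coe_lt_coe]
    push_cast at hu ⊢
    rwa [Real.coe_toNNReal u hu0, mul_comm]
  simp only [rescaledPath, h_floor]

theorem intervalIntegrable_comp_path (x : SkorokhodSpace) {ψ : ℝ → ℝ} (hψ : Continuous ψ) {C : ℝ}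
    (hC : ∀ u, |ψ u| ≤ C) (b c : ℝ) :
    IntervalIntegrable (fun u : ℝ => ψ (x u.toNNReal)) volume b c :=
  (intervalIntegrable_const (c := C)).mono_fun
    (hψ.measurable.comp x.measurable_path).aestronglyMeasurable
    (ae_of_all _ fun _ => (hC _).trans (le_abs_self C))

theorem sum_eq_integral_rescaledPath (a : ℝ) {n : ℕ} (hn : n ≠ 0) (s : ℕ → ℤ) {ψ : ℝ → ℝ}
    (hψ : Continuous ψ) {C : ℝ} (hC : ∀ u, |ψ u| ≤ C) (N : ℕ) :
    ∑ k ∈ Finset.range N, (n : ℝ)⁻¹ * ψ (a⁻¹ * s k) =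
      ∫ u in (0 : ℝ)..N / n, ψ (rescaledPath a n s u.toNNReal) := by
  have h := intervalIntegral.sum_integral_adjacent_intervals (μ := volume)
    (f := fun u : ℝ => ψ (rescaledPath a n s u.toNNReal)) (a := fun k : ℕ => (k : ℝ) / n)
    (n := N) fun k _ => intervalIntegrable_comp_path _ hψ hC _ _
  rw [Nat.cast_zero, zero_div] at h
  rw [← h]
  refine Finset.sum_congr rfl fun k _ => ?_
  have h_le : (k : ℝ) / n ≤ ((k + 1 : ℕ) : ℝ) / n := by gcongr; exact k.le_succ
  rw [intervalIntegral.integral_of_le h_le, ← integral_Ico_eq_integral_Ioc,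
    setIntegral_congr_fun (g := fun _ => ψ (a⁻¹ * s k)) measurableSet_Ico
      fun u hu => congrArg ψ (rescaledPath_toNNReal hn s hu),
    setIntegral_const, Real.volume_real_Ico_of_le h_le, smul_eq_mul]
  push_cast
  ring

theorem abs_sum_sub_occupationIntegral_le (a : ℝ) {n : ℕ} (hn : n ≠ 0) (s : ℕ → ℤ) (t : ℝ≥0)
    {ψ : ℝ → ℝ} (hψ : Continuous ψ) {C : ℝ} (hC : ∀ u, |ψ u| ≤ C) :
    |(∑ k ∈ Finset.range (⌊(n : ℝ≥0) * t⌋₊ + 1), (n : ℝ)⁻¹ * ψ (a⁻¹ * s k)) -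
      SkorokhodSpace.occupationIntegral ψ t (rescaledPath a n s)| ≤ C * (n : ℝ)⁻¹ := by
  have hn0 : (0 : ℝ) < n := by exact_mod_cast Nat.pos_of_ne_zero hn
  have hC0 : 0 ≤ C := (abs_nonneg _).trans (hC 0)
  have h_floor : (⌊(n : ℝ≥0) * t⌋₊ : ℝ) ≤ n * t := by
    exact_mod_cast Nat.floor_le (a := (n : ℝ≥0) * t) zero_le
  have h_lt : (n : ℝ) * t < ⌊(n : ℝ≥0) * t⌋₊ + 1 := by
    exact_mod_cast Nat.lt_floor_add_one ((n : ℝ≥0) * t)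
  rw [sum_eq_integral_rescaledPath a hn s hψ hC, SkorokhodSpace.occupationIntegral,
    integral_Icc_eq_integral_Ioc, ← intervalIntegral.integral_of_le t.coe_nonneg,
    intervalIntegral.integral_interval_sub_left (intervalIntegrable_comp_path _ hψ hC _ _)
      (intervalIntegrable_comp_path _ hψ hC _ _)]
  refine (intervalIntegral.norm_integral_le_of_norm_le_const
    (f := fun u : ℝ => ψ (rescaledPath a n s u.toNNReal)) fun u _ => hC _).trans
    (mul_le_mul_of_nonneg_left ?_ hC0)
  rw [Nat.cast_add_one, abs_of_nonneg]
  · rw [sub_le_iff_le_add, div_le_iff₀ hn0, add_mul, inv_mul_cancel₀ hn0.ne']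
    linarith
  · rw [sub_nonneg, le_div_iff₀ hn0]
    linarith

theorem eventually_abs_integral_mul_rescaledLocalTime_sub_le {a : ℕ → ℝ}
    (ha : Tendsto a atTop atTop) (t : ℝ≥0) {ψ : ℝ → ℝ} (hψ : UniformContinuous ψ) {C : ℝ}
    (hC : ∀ u, |ψ u| ≤ C) {ε : ℝ} (hε : 0 < ε) :
    ∀ᶠ n in atTop, ∀ s : ℕ → ℤ, |(∫ x, ψ x * rescaledLocalTime (a n) n s t x) -
      SkorokhodSpace.occupationIntegral ψ t (rescaledPath (a n) n s)| ≤ ε := by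
  set η : ℝ := ε / 2 / (t + 1)
  have hη : 0 < η := by positivity
  obtain ⟨d, hd, hdψ⟩ := Metric.uniformContinuous_iff.1 hψ η hη
  have h_inv : ∀ᶠ n in atTop, (a n)⁻¹ < d := ha.inv_tendsto_atTop.eventually_lt_const hd
  have h_C : ∀ᶠ n : ℕ in atTop, C * (n : ℝ)⁻¹ < ε / 2 := by
    have h := (tendsto_inv_atTop_nhds_zero_nat (𝕜 := ℝ)).const_mul C
    rw [mul_zero] at h
    exact h.eventually_lt_const (half_pos hε)
  filter_upwards [h_inv, h_C, ha.eventually_gt_atTop 0, eventually_ne_atTop 0]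
    with n hd' hCn ha0 hn s
  calc _ ≤ _ := abs_sub_le _
        (∑ k ∈ Finset.range (⌊(n : ℝ≥0) * t⌋₊ + 1), (n : ℝ)⁻¹ * ψ ((a n)⁻¹ * s k)) _
    _ ≤ (t + 1) * η + C * (n : ℝ)⁻¹ := add_le_add
        (abs_integral_mul_rescaledLocalTime_sub_sum_le ha0 hn s t hψ.continuous
          fun u v huv => (hdψ (huv.trans_lt hd')).le)
        (abs_sum_sub_occupationIntegral_le _ hn s t hψ.continuous hC)
    _ ≤ ε / 2 + ε / 2 := add_le_add (mul_div_cancel₀ _ (by positivity)).le hCn.le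
    _ = ε := add_halves ε

/-! ### Step functions of occupation integrals -/

/-- The function that is constant on the cells of mesh `1 / (J + 1)`, its value on each cell being
the occupation integral up to time `t` of the kernel of that cell. If `x` has an occupation density,
this is its cell average; but it makes sense for every path, and depends continuously on it. -/
noncomputable def occupationStep (t : ℝ≥0) (J : ℕ) (x : SkorokhodSpace) (y : ℝ) : ℝ :=
  SkorokhodSpace.occupationIntegral (cellKernel (mesh J) ⌊(mesh J)⁻¹ * y⌋) t x

theorem measurable_occupationStep (t : ℝ≥0) (J : ℕ) (x : SkorokhodSpace) :
    Measurable (occupationStep t J x) :=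
  (measurable_of_countable fun j : ℤ =>
    SkorokhodSpace.occupationIntegral (cellKernel (mesh J) j) t x).comp
    (measurable_floor_mul (mesh J)⁻¹)

section Measurability

variable {Ω : Type*} [MeasurableSpace Ω] {S : ℕ → Ω → ℤ}

theorem measurable_rescaledPath_prod (hS : ∀ k, Measurable (S k)) (a : ℝ) (n : ℕ) :
    Measurable fun z : Ω × ℝ≥0 => rescaledPath a n (fun k => S k z.1) z.2 := by
  have h : Measurable fun z : Ω × ℕ => S z.2 z.1 := measurable_from_prod_countable_left hS
  have h_floor : Measurable fun z : Ω × ℝ≥0 => ⌊(n : ℝ≥0) * z.2⌋₊ :=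
    Nat.measurable_floor.comp (measurable_snd.const_mul _)
  have h_comp := h.comp (measurable_fst.prodMk h_floor)
  exact ((measurable_of_countable fun k : ℤ => (k : ℝ)).comp h_comp).const_mul a⁻¹

theorem measurable_occupationIntegral_rescaledPath (hS : ∀ k, Measurable (S k)) (a : ℝ) (n : ℕ)
    {ψ : ℝ → ℝ} (hψ : Measurable ψ) (t : ℝ≥0) :
    Measurable fun ω =>
      SkorokhodSpace.occupationIntegral ψ t (rescaledPath a n fun k => S k ω) := by
  have h_path := (measurable_rescaledPath_prod hS a n).comp
    (measurable_fst.prodMk (measurable_snd (α := Ω) (β := ℝ)).real_toNNReal)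
  have h := (hψ.comp h_path).stronglyMeasurable
  exact (h.integral_prod_right' (ν := volume.restrict (Icc (0 : ℝ) t))).measurable

theorem measurable_occupationStep_prod (hS : ∀ k, Measurable (S k)) (a : ℝ) (n : ℕ) (t : ℝ≥0)
    (J : ℕ) :
    Measurable fun z : ℝ × Ω => occupationStep t J (rescaledPath a n fun k => S k z.2) z.1 := by
  have h : Measurable fun z : ℤ × Ω => SkorokhodSpace.occupationIntegral
      (cellKernel (mesh J) z.1) t (rescaledPath a n fun k => S k z.2) :=
    measurable_from_prod_countable_right fun j =>
      measurable_occupationIntegral_rescaledPath hS a n (continuous_cellKernel _ j).measurable t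
  have h_floor : Measurable fun z : ℝ × Ω => (⌊(mesh J)⁻¹ * z.1⌋, z.2) :=
    ((measurable_floor_mul _).comp measurable_fst).prodMk measurable_snd
  have h_comp := h.comp h_floor
  exact h_comp

end Measurability

theorem eventually_abs_cellAverage_sub_occupationStep_le {a : ℕ → ℝ}
    (ha : Tendsto a atTop atTop) (t : ℝ≥0) (M J : ℕ) {ε : ℝ} (hε : 0 < ε) :
    ∀ᶠ n in atTop, ∀ s : ℕ → ℤ, ∀ y ∈ window M,
      |cellAverage (mesh J) (rescaledLocalTime (a n) n s t) y -
        occupationStep t J (rescaledPath (a n) n s) y| ≤ ε := by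
  have h := (Finset.eventually_all (cellIndices M J)).2 fun j _ =>
    eventually_abs_integral_mul_rescaledLocalTime_sub_le ha t
      (uniformContinuous_cellKernel (mesh_pos J) j) (abs_cellKernel_le (mesh_pos J) j) hε
  filter_upwards [h] with n hn s y hy
  exact hn _ (floor_mem_cellIndices.2 hy) s

theorem eventually_eLpNorm_cellAverage_sub_occupationStep_le {a : ℕ → ℝ}
    (ha : Tendsto a atTop atTop) (t : ℝ≥0) (p : ℝ≥0∞) (M J : ℕ) {ε : ℝ≥0∞} (hε : 0 < ε) :
    ∀ᶠ n in atTop, ∀ s : ℕ → ℤ,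
      eLpNorm (fun y => cellAverage (mesh J) (rescaledLocalTime (a n) n s t) y -
        occupationStep t J (rescaledPath (a n) n s) y) p (volume.restrict (window M)) ≤ ε := by
  set K : ℝ≥0∞ := volume.restrict (window M) univ ^ p.toReal⁻¹
  have hK : K ≠ ∞ := ENNReal.rpow_ne_top_of_nonneg (by positivity) (measure_ne_top _ _)
  obtain ⟨η, hη, hKη⟩ := ENNReal.exists_nnreal_pos_mul_lt hK hε.ne'
  filter_upwards [eventually_abs_cellAverage_sub_occupationStep_le ha t M J
    (NNReal.coe_pos.2 hη)] with n hn s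
  have h_bound : ∀ᵐ y ∂volume.restrict (window M),
      ‖cellAverage (mesh J) (rescaledLocalTime (a n) n s t) y -
        occupationStep t J (rescaledPath (a n) n s) y‖ ≤ η :=
    (ae_restrict_mem (measurableSet_window M)).mono (hn s)
  refine (eLpNorm_le_of_ae_bound h_bound).trans ?_
  rw [ENNReal.ofReal_coe_nnreal, mul_comm]
  exact hKη.le

/-! ### The modulus of continuity in `L^p` -/

section Modulus

variable {Ω : Type*} [MeasurableSpace Ω] {P : Measure Ω} [IsProbabilityMeasure P] {S : ℕ → Ω → ℤ}
  {a : ℕ → ℝ} {p : ℝ≥0∞} {t : ℝ≥0}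

/-- Condition (RW2) at the single time `t`. -/
def VanishingLpModulus (P : Measure Ω) (S : ℕ → Ω → ℤ) (a : ℕ → ℝ) (p : ℝ≥0∞) (t : ℝ≥0) : Prop :=
  ∀ M : ℝ, 0 < M →
    Tendsto (fun δ : ℝ => limsup (fun n : ℕ => ∫⁻ x in Icc (-M) M, ∫⁻ ω,
        ‖rescaledLocalTime (a n) n (fun k => S k ω) t x
          - rescaledLocalTime (a n) n (fun k => S k ω) t (gridFloor δ x)‖ₑ ^ p.toReal ∂P) atTop)
      (𝓝[>] 0) (𝓝 0)

theorem measurable_rescaledLocalTime_sub_gridFloor_prod (hS : ∀ k, Measurable (S k)) (a : ℝ)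
    (n : ℕ) (t : ℝ≥0) (δ : ℝ) :
    Measurable fun z : ℝ × Ω => rescaledLocalTime a n (fun k => S k z.2) t z.1 -
      rescaledLocalTime a n (fun k => S k z.2) t (gridFloor δ z.1) := by
  have h := measurable_rescaledLocalTime_prod hS a n t
  have h_grid := h.comp (((measurable_gridFloor δ).comp measurable_fst).prodMk measurable_snd)
  exact h.sub h_grid

theorem VanishingLpModulus.eventually_lintegral_eLpNorm_sub_gridFloor_le
    (h : VanishingLpModulus P S a p t) (hS : ∀ k, Measurable (S k)) (hp1 : 1 ≤ p) (hp : p ≠ ∞)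
    (M : ℕ) {ε : ℝ≥0∞} (hε : 0 < ε) :
    ∀ᶠ J in atTop, ∀ᶠ n in atTop,
      ∫⁻ ω, eLpNorm (fun x => rescaledLocalTime (a n) n (fun k => S k ω) t x -
        rescaledLocalTime (a n) n (fun k => S k ω) t (gridFloor (mesh J) x)) p
        (volume.restrict (window M)) ∂P ≤ ε := by
  have hp0 : 0 < p.toReal := ENNReal.toReal_pos (one_pos.trans_le hp1).ne' hp
  have h_small := ((h (M + 1) (by positivity)).comp tendsto_mesh).eventually
    (gt_mem_nhds (ENNReal.rpow_pos_of_nonneg hε hp0.le))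
  refine h_small.mono fun J hJ => (eventually_lt_of_limsup_lt hJ).mono fun n hn => ?_
  refine (lintegral_eLpNorm_le
    (measurable_rescaledLocalTime_sub_gridFloor_prod hS (a n) n t (mesh J)) hp1 hp).trans ?_
  rw [one_div, ENNReal.rpow_inv_le_iff hp0]
  refine (lintegral_mono_set fun x hx => ?_).trans hn.le
  exact ⟨by linarith [hx.1], by linarith [hx.2]⟩

theorem eLpNorm_rescaledLocalTime_sub_occupationStep_le (a : ℝ) (n : ℕ) (s : ℕ → ℤ) (t : ℝ≥0)
    (hp1 : 1 ≤ p) (hp : p ≠ ∞) (M J : ℕ) :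
    eLpNorm (fun x => rescaledLocalTime a n s t x - occupationStep t J (rescaledPath a n s) x) p
        (volume.restrict (window M)) ≤
      3 * eLpNorm (fun x => rescaledLocalTime a n s t x -
        rescaledLocalTime a n s t (gridFloor (mesh J) x)) p (volume.restrict (window M)) +
      eLpNorm (fun x => cellAverage (mesh J) (rescaledLocalTime a n s t) x -
        occupationStep t J (rescaledPath a n s) x) p (volume.restrict (window M)) := by
  have h_meas := measurable_rescaledLocalTime a n s t
  have h_average := measurable_cellAverage (mesh J) (rescaledLocalTime a n s t)
  have h_add := eLpNorm_add_le (p := p) (μ := volume.restrict (window M))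
    (h_meas.sub h_average).aestronglyMeasurable
    (h_average.sub (measurable_occupationStep t J (rescaledPath a n s))).aestronglyMeasurable hp1
  rw [sub_add_sub_cancel] at h_add
  exact h_add.trans (add_le_add_left
    (eLpNorm_sub_cellAverage_le M J (integrable_rescaledLocalTime a n s t) h_meas hp1 hp) _)

theorem VanishingLpModulus.eventually_lintegral_eLpNorm_sub_occupationStep_le
    (h : VanishingLpModulus P S a p t) (hS : ∀ k, Measurable (S k)) (ha : Tendsto a atTop atTop)
    (hp1 : 1 ≤ p) (hp : p ≠ ∞) (M : ℕ) {ε : ℝ≥0∞} (hε : 0 < ε) :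
    ∀ᶠ J in atTop, ∀ᶠ n in atTop,
      ∫⁻ ω, eLpNorm (fun x => rescaledLocalTime (a n) n (fun k => S k ω) t x -
        occupationStep t J (rescaledPath (a n) n fun k => S k ω) x) p
        (volume.restrict (window M)) ∂P ≤ ε := by
  have hε4 : 0 < ε / 4 := ENNReal.div_pos hε.ne' (by simp)
  filter_upwards [h.eventually_lintegral_eLpNorm_sub_gridFloor_le hS hp1 hp M hε4] with J hJ
  filter_upwards [hJ, eventually_eLpNorm_cellAverage_sub_occupationStep_le ha t p M J hε4]
    with n h_modulus h_step
  have h_meas := measurable_eLpNorm_prod (μ := volume.restrict (window M))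
    (measurable_rescaledLocalTime_sub_gridFloor_prod hS (a n) n t (mesh J))
    (one_pos.trans_le hp1).ne' hp
  calc _ ≤ ∫⁻ ω, (3 * eLpNorm (fun x => rescaledLocalTime (a n) n (fun k => S k ω) t x -
          rescaledLocalTime (a n) n (fun k => S k ω) t (gridFloor (mesh J) x)) p
          (volume.restrict (window M)) + ε / 4) ∂P :=
        lintegral_mono fun ω => (eLpNorm_rescaledLocalTime_sub_occupationStep_le (a n) n _ t hp1 hp
          M J).trans (add_le_add_right (h_step _) _)
    _ ≤ 3 * (ε / 4) + ε / 4 := by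
        rw [lintegral_add_right _ measurable_const, lintegral_const_mul _ h_meas, lintegral_const,
          measure_univ, mul_one]
        gcongr
    _ = 4 * (ε / 4) := by ring
    _ = ε := ENNReal.mul_div_cancel (by simp) (by simp)

end Modulus

/-! ### Linear combinations at several times -/

theorem eLpNorm_sum_mul_sub_sum_mul_le {α ι : Type*} [MeasurableSpace α] [Fintype ι]
    {μ : Measure α} {p : ℝ≥0∞} (hp1 : 1 ≤ p) (θ : ι → ℝ) {f g : ι → α → ℝ}
    (hf : ∀ i, AEStronglyMeasurable (f i) μ) (hg : ∀ i, AEStronglyMeasurable (g i) μ) :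
    eLpNorm (fun x => (∑ i, θ i * f i x) - ∑ i, θ i * g i x) p μ ≤
      ∑ i, ‖θ i‖ₑ * eLpNorm (fun x => f i x - g i x) p μ := by
  have h_eq : (fun x => (∑ i, θ i * f i x) - ∑ i, θ i * g i x) =
      ∑ i, θ i • fun x => f i x - g i x := by
    ext x
    simp only [Finset.sum_apply, Pi.smul_apply, smul_eq_mul, mul_sub, Finset.sum_sub_distrib]
  rw [h_eq]
  refine (eLpNorm_sum_le (fun i _ => ((hf i).sub (hg i)).const_smul (θ i)) hp1).trans_eq ?_
  exact Finset.sum_congr rfl fun i _ => eLpNorm_const_smul _ _ _ _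

section Combination

variable {ι : Type*} [Fintype ι]

/-- The combination `∑ i, θ i * L_n(t i, ·)` of rescaled discrete local times. -/
noncomputable def combinedLocalTime (θ : ι → ℝ) (t : ι → ℝ≥0) (a : ℝ) (n : ℕ) (s : ℕ → ℤ) (x : ℝ) :
    ℝ :=
  ∑ i, θ i * rescaledLocalTime a n s (t i) x

/-- The combination of the step functions `occupationStep (t i) J x` with weights `θ i`. -/
noncomputable def combinedStep (θ : ι → ℝ) (t : ι → ℝ≥0) (J : ℕ) (x : SkorokhodSpace) (y : ℝ) : ℝ :=
  ∑ i, θ i * occupationStep (t i) J x y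

/-- The distance in `L^p` of the window `[-M, M)` between `f` and the step function attached to the
path `x`. -/
noncomputable def stepError (p : ℝ≥0∞) (θ : ι → ℝ) (t : ι → ℝ≥0) (M J : ℕ) (f : ℝ → ℝ)
    (x : SkorokhodSpace) : ℝ≥0∞ :=
  eLpNorm (fun y => f y - combinedStep θ t J x y) p (volume.restrict (window M))

variable {θ : ι → ℝ} {t : ι → ℝ≥0} {p : ℝ≥0∞}

theorem measurable_combinedLocalTime (a : ℝ) (n : ℕ) (s : ℕ → ℤ) :
    Measurable (combinedLocalTime θ t a n s) :=
  Finset.measurable_fun_sum _ fun _ _ => (measurable_rescaledLocalTime _ _ _ _).const_mul _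

theorem memLp_combinedLocalTime (a : ℝ) (n : ℕ) (s : ℕ → ℤ) :
    MemLp (combinedLocalTime θ t a n s) p :=
  memLp_finsetSum _ fun _ _ => (memLp_rescaledLocalTime _ _ _ _ p).const_mul _

theorem combinedLocalTime_eq_zero {a : ℝ} (ha : 1 ≤ a) {n : ℕ} (hn : n ≠ 0) {s : ℕ → ℤ} {K : ℝ}
    (h : ∀ i, ∀ r ≤ t i, |rescaledPath a n s r| < K) {M : ℕ} (hM : K + 1 ≤ M) {x : ℝ}
    (hx : x ∉ window M) : combinedLocalTime θ t a n s x = 0 :=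
  Finset.sum_eq_zero fun i _ => by rw [rescaledLocalTime_eq_zero ha hn (h i) hM hx, mul_zero]

theorem measurable_combinedStep (J : ℕ) (x : SkorokhodSpace) : Measurable (combinedStep θ t J x) :=
  Finset.measurable_fun_sum _ fun _ _ => (measurable_occupationStep _ _ _).const_mul _

section Discrete

variable {Ω : Type*} [MeasurableSpace Ω] {P : Measure Ω} {S : ℕ → Ω → ℤ}

theorem measurable_combinedLocalTime_prod (hS : ∀ k, Measurable (S k)) (a : ℝ) (n : ℕ) :
    Measurable fun z : ℝ × Ω => combinedLocalTime θ t a n (fun k => S k z.2) z.1 :=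
  Finset.measurable_fun_sum _ fun i _ =>
    (measurable_rescaledLocalTime_prod hS a n (t i)).const_mul _

theorem measurable_combinedStep_prod (hS : ∀ k, Measurable (S k)) (a : ℝ) (n J : ℕ) :
    Measurable fun z : ℝ × Ω => combinedStep θ t J (rescaledPath a n fun k => S k z.2) z.1 :=
  Finset.measurable_fun_sum _ fun i _ => (measurable_occupationStep_prod hS a n (t i) J).const_mul _

theorem measurable_stepError (hS : ∀ k, Measurable (S k)) (hp0 : p ≠ 0) (hp : p ≠ ∞) (a : ℝ)
    (n M J : ℕ) :
    Measurable fun ω => stepError p θ t M J (combinedLocalTime θ t a n fun k => S k ω)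
      (rescaledPath a n fun k => S k ω) := by
  have h_sub : Measurable fun z : ℝ × Ω => combinedLocalTime θ t a n (fun k => S k z.2) z.1 -
      combinedStep θ t J (rescaledPath a n fun k => S k z.2) z.1 :=
    (measurable_combinedLocalTime_prod hS a n).sub (measurable_combinedStep_prod hS a n J)
  have h_norm := measurable_eLpNorm_prod (μ := volume.restrict (window M)) h_sub hp0 hp
  exact h_norm

theorem lintegral_stepError_le (hS : ∀ k, Measurable (S k)) (hp1 : 1 ≤ p) (hp : p ≠ ∞) (a : ℝ)
    (n M J : ℕ) :
    ∫⁻ ω, stepError p θ t M J (combinedLocalTime θ t a n fun k => S k ω)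
        (rescaledPath a n fun k => S k ω) ∂P ≤
      ∑ i, ‖θ i‖ₑ * ∫⁻ ω, eLpNorm (fun x => rescaledLocalTime a n (fun k => S k ω) (t i) x -
        occupationStep (t i) J (rescaledPath a n fun k => S k ω) x) p
        (volume.restrict (window M)) ∂P := by
  have h_sub (i : ι) : Measurable fun z : ℝ × Ω =>
      rescaledLocalTime a n (fun k => S k z.2) (t i) z.1 -
        occupationStep (t i) J (rescaledPath a n fun k => S k z.2) z.1 :=
    (measurable_rescaledLocalTime_prod hS a n (t i)).sub
      (measurable_occupationStep_prod hS a n (t i) J)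
  have h_meas (i : ι) := measurable_eLpNorm_prod (μ := volume.restrict (window M))
    (h_sub i) (one_pos.trans_le hp1).ne' hp
  refine (lintegral_mono fun ω => eLpNorm_sum_mul_sub_sum_mul_le hp1 θ
    (fun i => (measurable_rescaledLocalTime a n (fun k => S k ω) (t i)).aestronglyMeasurable)
    fun i => (measurable_occupationStep (t i) J _).aestronglyMeasurable).trans_eq ?_
  rw [lintegral_finsetSum _ fun i _ => (h_meas i).const_mul _]
  exact Finset.sum_congr rfl fun i _ => lintegral_const_mul _ (h_meas i)

theorem eventually_lintegral_stepError_le [IsProbabilityMeasure P] (hS : ∀ k, Measurable (S k))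
    {a : ℕ → ℝ} (ha : Tendsto a atTop atTop) (hp1 : 1 ≤ p) (hp : p ≠ ∞)
    (h : ∀ i, VanishingLpModulus P S a p (t i)) (M : ℕ) {ε : ℝ≥0∞} (hε : 0 < ε) :
    ∀ᶠ J in atTop, ∀ᶠ n in atTop,
      ∫⁻ ω, stepError p θ t M J (combinedLocalTime θ t (a n) n fun k => S k ω)
        (rescaledPath (a n) n fun k => S k ω) ∂P ≤ ε := by
  have h_weight : ∑ i, ‖θ i‖ₑ ≠ ∞ := ENNReal.sum_ne_top.2 fun i _ => enorm_ne_top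
  have hη : 0 < ε / ∑ i, ‖θ i‖ₑ := ENNReal.div_pos hε.ne' h_weight
  filter_upwards [eventually_all.2 fun i =>
    (h i).eventually_lintegral_eLpNorm_sub_occupationStep_le hS ha hp1 hp M hη] with J hJ
  filter_upwards [eventually_all.2 hJ] with n hn
  calc _ ≤ _ := lintegral_stepError_le hS hp1 hp (a n) n M J
    _ ≤ ∑ i, ‖θ i‖ₑ * (ε / ∑ i, ‖θ i‖ₑ) :=
        Finset.sum_le_sum fun i _ => mul_le_mul_right (hn i) _
    _ = (∑ i, ‖θ i‖ₑ) * (ε / ∑ i, ‖θ i‖ₑ) := by rw [Finset.sum_mul]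
    _ ≤ ε := ENNReal.mul_div_le

end Discrete

/-! ### Step functions as elements of `L^p` -/

/-- The element of `L^p(ℝ)` that equals `c j` on the cell of index `j`, for the cells of mesh
`1 / (J + 1)` in the window `[-M, M)`, and vanishes elsewhere. -/
noncomputable def cellStep (p : ℝ≥0∞) (M J : ℕ) (c : ℤ → ℝ) :
    Lp ℝ p (volume : Measure ℝ) :=
  ∑ j ∈ cellIndices M J, c j •
    indicatorConstLp p (measurableSet_cell (mesh J) j) (volume_cell_ne_top (mesh_pos J).ne' j)
      (1 : ℝ)

theorem sum_indicator_cell (M J : ℕ) (c : ℤ → ℝ) (x : ℝ) :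
    ∑ j ∈ cellIndices M J, (cell (mesh J) j).indicator (fun _ => c j) x =
      (window M).indicator (fun x => c ⌊(mesh J)⁻¹ * x⌋) x := by
  by_cases h : x ∈ window M
  · rw [indicator_of_mem h, Finset.sum_eq_single_of_mem _ (floor_mem_cellIndices (J := J).2 h),
      indicator_of_mem (mem_cell.2 rfl)]
    exact fun j _ hj => indicator_of_notMem (fun hx => hj (mem_cell.1 hx).symm) _
  · rw [indicator_of_notMem h]
    refine Finset.sum_eq_zero fun j hj => indicator_of_notMem (fun hx => h ?_) _
    rw [← mem_cell.1 hx] at hj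
    exact floor_mem_cellIndices.1 hj

theorem coeFn_cellStep (M J : ℕ) (c : ℤ → ℝ) :
    cellStep p M J c =ᵐ[volume] (window M).indicator fun x => c ⌊(mesh J)⁻¹ * x⌋ := by
  have h_cell (j : ℤ) : (c j • indicatorConstLp p (measurableSet_cell (mesh J) j)
      (volume_cell_ne_top (mesh_pos J).ne' j) (1 : ℝ) : Lp ℝ p (volume : Measure ℝ)) =ᵐ[volume]
      (cell (mesh J) j).indicator fun _ => c j := by
    filter_upwards [Lp.coeFn_smul (c j) (indicatorConstLp p (measurableSet_cell (mesh J) j)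
      (volume_cell_ne_top (mesh_pos J).ne' j) (1 : ℝ)), indicatorConstLp_coeFn (p := p)
      (hs := measurableSet_cell (mesh J) j) (hμs := volume_cell_ne_top (mesh_pos J).ne' j)
      (c := (1 : ℝ))] with x h_smul h_indicator
    rw [h_smul, Pi.smul_apply, h_indicator]
    by_cases h : x ∈ cell (mesh J) j <;> simp [h]
  filter_upwards [Lp.coeFn_finsetSum (cellIndices M J) fun j => (c j • indicatorConstLp p
    (measurableSet_cell (mesh J) j) (volume_cell_ne_top (mesh_pos J).ne' j) (1 : ℝ) :
      Lp ℝ p (volume : Measure ℝ)), ae_all_iff.2 h_cell] with x h_sum hx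
  rw [cellStep, h_sum, Finset.sum_apply, Finset.sum_congr rfl fun j _ => hx j, sum_indicator_cell]

/-- The step function `combinedStep θ t J x` cut off to the window `[-M, M)`, in `L^p(ℝ)`. -/
noncomputable def stepMap (p : ℝ≥0∞) (θ : ι → ℝ) (t : ι → ℝ≥0) (M J : ℕ)
    (x : SkorokhodSpace) : Lp ℝ p (volume : Measure ℝ) :=
  cellStep p M J fun j =>
    ∑ i, θ i * SkorokhodSpace.occupationIntegral (cellKernel (mesh J) j) (t i) x

theorem continuous_stepMap [Fact (1 ≤ p)] (M J : ℕ) : Continuous (stepMap p θ t M J) := by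
  have h_coeff (j : ℤ) : Continuous fun x =>
      ∑ i, θ i * SkorokhodSpace.occupationIntegral (cellKernel (mesh J) j) (t i) x :=
    continuous_finsetSum _ fun i _ => continuous_const.mul
      (SkorokhodSpace.continuous_occupationIntegral (continuous_cellKernel _ _)
        (abs_cellKernel_le (mesh_pos J) j) _)
  unfold stepMap cellStep
  exact continuous_finsetSum _ fun j _ => (h_coeff j).smul (continuous_const
    (y := indicatorConstLp p (measurableSet_cell (mesh J) j)
      (volume_cell_ne_top (mesh_pos J).ne' j) (1 : ℝ)))

theorem coeFn_stepMap (M J : ℕ) (x : SkorokhodSpace) :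
    stepMap p θ t M J x =ᵐ[volume] (window M).indicator (combinedStep θ t J x) :=
  coeFn_cellStep M J _

theorem edist_stepMap_eq {M J : ℕ} {x : SkorokhodSpace} {u : Lp ℝ p (volume : Measure ℝ)}
    {f : ℝ → ℝ} (hu : u =ᵐ[volume] (window M).indicator f) :
    edist u (stepMap p θ t M J x) = stepError p θ t M J f x := by
  rw [Lp.edist_def, stepError, ← eLpNorm_indicator_eq_eLpNorm_restrict (measurableSet_window M)]
  refine eLpNorm_congr_ae ?_
  filter_upwards [hu, coeFn_stepMap (p := p) (θ := θ) (t := t) M J x] with y hy h_step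
  rw [Pi.sub_apply, hy, h_step]
  by_cases h : y ∈ window M
  · simp only [indicator_of_mem h]
  · simp only [indicator_of_notMem h, sub_zero]

theorem edist_stepMap_stepMap_le [Fact (1 ≤ p)] {M J J' : ℕ} {x : SkorokhodSpace}
    {f : ℝ → ℝ} (hf : Measurable f) :
    edist (stepMap p θ t M J x) (stepMap p θ t M J' x) ≤
      stepError p θ t M J f x + stepError p θ t M J' f x := by
  have h_add := eLpNorm_add_le (p := p) (μ := volume.restrict (window M))
    ((measurable_combinedStep (θ := θ) (t := t) J x).sub hf).aestronglyMeasurable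
    (hf.sub (measurable_combinedStep (θ := θ) (t := t) J' x)).aestronglyMeasurable Fact.out
  rw [sub_add_sub_cancel, eLpNorm_sub_comm (combinedStep θ t J x) f] at h_add
  rw [edist_stepMap_eq (coeFn_stepMap M J x)]
  exact h_add

end Combination

/-! ### Occupation densities -/

/-- `ℓ` is a density, with respect to Lebesgue measure, of the occupation measure up to time `u` of
the path `x`. This is the condition that `IsLocalTime` imposes on almost every path. -/
structure IsOccupationDensity (x : SkorokhodSpace) (u : ℝ≥0) (ℓ : ℝ → ℝ) : Prop where
  measurable : Measurable ℓ
  nonneg : ∀ y, 0 ≤ ℓ y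
  volume_eq : ∀ B : Set ℝ, MeasurableSet B →
    volume {s : ℝ | 0 ≤ s ∧ s ≤ (u : ℝ) ∧ x s.toNNReal ∈ B} = ∫⁻ y in B, ENNReal.ofReal (ℓ y)

theorem IsLocalTime.ae_isOccupationDensity {ι Ω : Type*} [Countable ι] [MeasurableSpace Ω]
    {P : Measure Ω} {Y : Ω → SkorokhodSpace} {L : ℝ≥0 → ℝ → Ω → ℝ} (hL : IsLocalTime P Y L)
    (t : ι → ℝ≥0) : ∀ᵐ ω ∂P, ∀ i, IsOccupationDensity (Y ω) (t i) fun y => L (t i) y ω := by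
  filter_upwards [ae_all_iff.2 fun i => hL.occupation (t i)] with ω hω i
  exact ⟨(hL.measurable (t i)).comp measurable_prodMk_right, fun y => hL.nonneg _ y ω, hω i⟩

namespace IsOccupationDensity

variable {x : SkorokhodSpace} {u : ℝ≥0} {ℓ : ℝ → ℝ}

theorem integrable (h : IsOccupationDensity x u ℓ) : Integrable ℓ := by
  refine ⟨h.measurable.aestronglyMeasurable, ?_⟩
  have h_univ := h.volume_eq univ MeasurableSet.univ
  rw [Measure.restrict_univ] at h_univ
  rw [hasFiniteIntegral_iff_ofReal (ae_of_all _ h.nonneg), ← h_univ]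
  exact (measure_mono (t := Icc (0 : ℝ) u) fun s hs => ⟨hs.1, hs.2.1⟩).trans_lt measure_Icc_lt_top

theorem map_restrict_eq (h : IsOccupationDensity x u ℓ) :
    (volume.restrict (Icc (0 : ℝ) u)).map (fun s : ℝ => x s.toNNReal) =
      volume.withDensity fun y => ENNReal.ofReal (ℓ y) := by
  ext B hB
  rw [Measure.map_apply x.measurable_path hB, withDensity_apply _ hB, ← h.volume_eq B hB,
    Measure.restrict_apply (x.measurable_path hB)]
  congr 1
  ext s
  exact ⟨fun hs => ⟨hs.2.1, hs.2.2, hs.1⟩, fun hs => ⟨hs.2.2, hs.1, hs.2.1⟩⟩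

theorem occupationIntegral_eq (h : IsOccupationDensity x u ℓ) {ψ : ℝ → ℝ} (hψ : Measurable ψ) :
    SkorokhodSpace.occupationIntegral ψ u x = ∫ y, ψ y * ℓ y := by
  rw [SkorokhodSpace.occupationIntegral,
    ← integral_map x.measurable_path.aemeasurable hψ.aestronglyMeasurable, h.map_restrict_eq,
    integral_withDensity_eq_integral_toReal_smul h.measurable.ennreal_ofReal
      (ae_of_all _ fun _ => ENNReal.ofReal_lt_top)]
  simp only [ENNReal.toReal_ofReal (h.nonneg _), smul_eq_mul, mul_comm]

theorem ae_eq_zero (h : IsOccupationDensity x u ℓ) {K : ℝ} (hx : ∀ r ≤ u, |x r| < K) {M : ℕ}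
    (hM : K ≤ M) : ∀ᵐ y, y ∉ window M → ℓ y = 0 := by
  have h_compl := h.volume_eq (window M)ᶜ (measurableSet_window M).compl
  have h_empty : {s : ℝ | 0 ≤ s ∧ s ≤ (u : ℝ) ∧ x s.toNNReal ∈ (window M)ᶜ} = ∅ := by
    refine eq_empty_of_forall_notMem fun s hs => hs.2.2 ?_
    have h_lt := abs_lt.1 ((hx _ (Real.toNNReal_le_iff_le_coe.2 hs.2.1)).trans_le hM)
    exact ⟨h_lt.1.le, h_lt.2⟩
  rw [h_empty, measure_empty, eq_comm, lintegral_eq_zero_iff h.measurable.ennreal_ofReal,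
    Filter.EventuallyEq, ae_restrict_iff' (measurableSet_window M).compl] at h_compl
  filter_upwards [h_compl] with y hy hyM
  exact le_antisymm (ENNReal.ofReal_eq_zero.1 (hy hyM)) (h.nonneg y)

theorem ae_tendsto_occupationStep (h : IsOccupationDensity x u ℓ) :
    ∀ᵐ y, Tendsto (fun J => occupationStep u J x y) atTop (𝓝 (ℓ y)) := by
  filter_upwards [ae_tendsto_cellAverage h.integrable] with y hy
  have h_step (J : ℕ) : occupationStep u J x y = cellAverage (mesh J) ℓ y :=
    h.occupationIntegral_eq (continuous_cellKernel _ _).measurable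
  simpa only [h_step] using hy

variable {ι : Type*} [Fintype ι] {θ : ι → ℝ} {t : ι → ℝ≥0} {ℓ : ι → ℝ → ℝ}

theorem ae_tendsto_combinedStep (h : ∀ i, IsOccupationDensity x (t i) (ℓ i)) :
    ∀ᵐ y, Tendsto (fun J => combinedStep θ t J x y) atTop (𝓝 (∑ i, θ i * ℓ i y)) := by
  filter_upwards [ae_all_iff.2 fun i => (h i).ae_tendsto_occupationStep] with y hy
  exact tendsto_finsetSum _ fun i _ => (hy i).const_mul (θ i)

theorem ae_sum_mul_eq_zero (h : ∀ i, IsOccupationDensity x (t i) (ℓ i)) {K : ℝ}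
    (hx : ∀ i, ∀ r ≤ t i, |x r| < K) {M : ℕ} (hM : K ≤ M) :
    ∀ᵐ y, y ∉ window M → ∑ i, θ i * ℓ i y = 0 := by
  filter_upwards [ae_all_iff.2 fun i => (h i).ae_eq_zero (hx i) hM] with y hy hyM
  exact Finset.sum_eq_zero fun i _ => by rw [hy i hyM, mul_zero]

end IsOccupationDensity

/-! ### Passage to the limit -/

section LimitStep

variable {ι : Type*} [Fintype ι] {θ : ι → ℝ} {t : ι → ℝ≥0} {p : ℝ≥0∞}

theorem memLp_combinedStep_restrict_window (M J : ℕ) (x : SkorokhodSpace) :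
    MemLp (combinedStep θ t J x) p (volume.restrict (window M)) :=
  (memLp_indicator_iff_restrict (measurableSet_window M)).1
    ((memLp_congr_ae (coeFn_stepMap M J x)).1 (Lp.memLp (stepMap p θ t M J x)))

theorem stepError_eq_top {M : ℕ} {f : ℝ → ℝ} (hf : Measurable f)
    (h : eLpNorm f p (volume.restrict (window M)) = ∞) (J : ℕ) (x : SkorokhodSpace) :
    stepError p θ t M J f x = ∞ := by
  by_contra h_err
  have h_sub : MemLp (fun y => f y - combinedStep θ t J x y) p (volume.restrict (window M)) :=
    ⟨(hf.sub (measurable_combinedStep J x)).aestronglyMeasurable, lt_top_iff_ne_top.2 h_err⟩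
  have h_add := h_sub.add (memLp_combinedStep_restrict_window (θ := θ) (t := t) M J x)
  refine h_add.2.ne (Eq.trans ?_ h)
  congr 1
  ext y
  exact sub_add_cancel _ _

theorem min_one_stepError_le_liminf {x : SkorokhodSpace} {f : ℝ → ℝ}
    (hf : ∀ᵐ y, Tendsto (fun J => combinedStep θ t J x y) atTop (𝓝 (f y))) (M J : ℕ) :
    min 1 (stepError p θ t M J f x) ≤
      liminf (fun J' => min 1 (edist (stepMap p θ t M J' x) (stepMap p θ t M J x))) atTop := by
  have h_fatou : stepError p θ t M J f x ≤
      liminf (fun J' => edist (stepMap p θ t M J' x) (stepMap p θ t M J x)) atTop := by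
    simp only [edist_stepMap_eq (coeFn_stepMap M _ x)]
    refine Lp.eLpNorm_lim_le_liminf_eLpNorm
      (fun J' => ((measurable_combinedStep J' x).sub
        (measurable_combinedStep J x)).aestronglyMeasurable) _ ?_
    filter_upwards [ae_restrict_of_ae hf] with y hy
    exact hy.sub_const _
  refine (min_le_min_left 1 h_fatou).trans_eq ?_
  exact Monotone.map_liminf_of_continuousAt (f := fun u : ℝ≥0∞ => min 1 u)
    (fun _ _ h => min_le_min_left 1 h) _ (continuous_const.min continuous_id).continuousAt

theorem lintegral_min_one_edist_stepMap_le {Ω : Type*} [MeasurableSpace Ω] {P : Measure Ω}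
    {X : Ω → SkorokhodSpace} {M : ℕ} {u : Ω → Lp ℝ p (volume : Measure ℝ)} {f : Ω → ℝ → ℝ}
    (hu : ∀ᵐ ω ∂P, u ω =ᵐ[volume] f ω) {A : Set Ω} (hA : NullMeasurableSet A P)
    (hf : ∀ᵐ ω ∂P, ω ∉ A → ∀ᵐ y, y ∉ window M → f ω y = 0) (J : ℕ) :
    ∫⁻ ω, min 1 (edist (u ω) (stepMap p θ t M J (X ω))) ∂P ≤
      P A + ∫⁻ ω, min 1 (stepError p θ t M J (f ω) (X ω)) ∂P := by
  have h_indicator : AEMeasurable (A.indicator (1 : Ω → ℝ≥0∞)) P := aemeasurable_one.indicator₀ hA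
  rw [← lintegral_indicator_one₀ hA, ← lintegral_add_left' h_indicator]
  refine lintegral_mono_ae ?_
  filter_upwards [hu, hf] with ω hω h_zero
  by_cases hωA : ω ∈ A
  · rw [indicator_of_mem hωA]
    exact (min_le_left _ _).trans le_self_add
  · rw [indicator_of_notMem hωA, zero_add]
    refine min_le_min_left 1 (edist_stepMap_eq ?_).le
    filter_upwards [hω, h_zero hωA] with y hy hy0
    by_cases hyM : y ∈ window M
    · rw [hy, indicator_of_mem hyM]
    · rw [hy, indicator_of_notMem hyM, hy0 hyM]

end LimitStep

section Limit

variable {ι Ω Ω' : Type*} [Fintype ι] [MeasurableSpace Ω] [MeasurableSpace Ω'] {P : Measure Ω}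
  {P' : Measure Ω'} {S : ℕ → Ω → ℤ} {a : ℕ → ℝ} {Y : Ω' → SkorokhodSpace}
  {L : ℝ≥0 → ℝ → Ω' → ℝ} {p : ℝ≥0∞} {θ : ι → ℝ} {t : ι → ℝ≥0}

theorem ae_eLpNorm_restrict_window_ne_top (hp0 : p ≠ 0) (hp : p ≠ ∞) {V : ℝ × Ω' → ℝ}
    (hV : Measurable V) (M : ℕ)
    (h : ∀ ε : ℝ≥0∞, 0 < ε → ∀ᶠ J in atTop,
      ∫⁻ ω, min 1 (stepError p θ t M J (fun y => V (y, ω)) (Y ω)) ∂P' ≤ ε) :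
    ∀ᵐ ω ∂P', eLpNorm (fun y => V (y, ω)) p (volume.restrict (window M)) ≠ ∞ := by
  set A : Set Ω' := {ω | eLpNorm (fun y => V (y, ω)) p (volume.restrict (window M)) = ∞}
  have hA : MeasurableSet A := measurable_eLpNorm_prod hV hp0 hp (measurableSet_singleton ∞)
  suffices h_le : ∀ ε : ℝ≥0∞, 0 < ε → P' A ≤ ε from
    measure_eq_zero_iff_ae_notMem.1 (nonpos_iff_eq_zero.1 (le_of_forall_gt_imp_ge_of_dense h_le))
  intro ε hε
  obtain ⟨J, hJ⟩ := (h ε hε).exists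
  rw [← lintegral_indicator_one hA]
  have h_top (ω : Ω') (hω : ω ∈ A) : stepError p θ t M J (fun y => V (y, ω)) (Y ω) = ∞ :=
    stepError_eq_top (hV.comp measurable_prodMk_right) hω J (Y ω)
  exact (lintegral_mono (indicator_le fun ω hω => le_min le_rfl (by simp [h_top ω hω]))).trans hJ

theorem IsLocalTime.measurable_sum_mul (hL : IsLocalTime P' Y L) :
    Measurable fun z : ℝ × Ω' => ∑ i, θ i * L (t i) z.1 z.2 :=
  Finset.measurable_fun_sum _ fun i _ => (hL.measurable (t i)).const_mul (θ i)

theorem IsLocalTime.ae_memLp_sum_mul (hp0 : p ≠ 0) (hp : p ≠ ∞) (hL : IsLocalTime P' Y L)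
    (h : ∀ M : ℕ, ∀ ε : ℝ≥0∞, 0 < ε → ∀ᶠ J in atTop, ∫⁻ ω, min 1 (stepError p θ t M J
      (fun y => ∑ i, θ i * L (t i) y ω) (Y ω)) ∂P' ≤ ε) :
    ∀ᵐ ω ∂P', MemLp (fun y => ∑ i, θ i * L (t i) y ω) p := by
  filter_upwards [hL.ae_isOccupationDensity t,
    ae_all_iff.2 fun M =>
      ae_eLpNorm_restrict_window_ne_top hp0 hp hL.measurable_sum_mul M (h M)]
    with ω h_density h_window
  obtain ⟨C, hC⟩ := (Y ω).2.exists_abs_le (Finset.univ.sup t)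
  obtain ⟨M, hM⟩ := exists_nat_gt C
  have h_zero := IsOccupationDensity.ae_sum_mul_eq_zero (θ := θ) h_density
    (fun i r hr => (hC r (hr.trans (Finset.le_sup (Finset.mem_univ i)))).trans_lt hM) le_rfl
  have h_indicator : (fun y => ∑ i, θ i * L (t i) y ω) =ᵐ[volume]
      (window M).indicator fun y => ∑ i, θ i * L (t i) y ω := by
    filter_upwards [h_zero] with y hy
    exact (indicator_apply_eq_self (s := window M)
      (f := fun y => ∑ i, θ i * L (t i) y ω).2 hy).symm
  refine ⟨(hL.measurable_sum_mul.comp measurable_prodMk_right).aestronglyMeasurable, ?_⟩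
  rw [eLpNorm_congr_ae h_indicator,
    eLpNorm_indicator_eq_eLpNorm_restrict (measurableSet_window M)]
  exact (h_window M).lt_top

variable [IsProbabilityMeasure P] [IsProbabilityMeasure P']

theorem lintegral_min_one_edist_stepMap_stepMap_le [Fact (1 ≤ p)]
    (hS : ∀ k, Measurable (S k)) (hp : p ≠ ∞)
    (hY : TendstoInDistribution (fun (n : ℕ) (ω : Ω) => rescaledPath (a n) n fun k => S k ω)
      atTop Y (fun _ => P) P') {M J J' : ℕ} {ε : ℝ≥0∞}
    (hJ : ∀ᶠ n in atTop, ∫⁻ ω, stepError p θ t M J (combinedLocalTime θ t (a n) n fun k => S k ω)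
      (rescaledPath (a n) n fun k => S k ω) ∂P ≤ ε)
    (hJ' : ∀ᶠ n in atTop, ∫⁻ ω, stepError p θ t M J' (combinedLocalTime θ t (a n) n fun k => S k ω)
      (rescaledPath (a n) n fun k => S k ω) ∂P ≤ ε) :
    ∫⁻ ω, min 1 (edist (stepMap p θ t M J (Y ω)) (stepMap p θ t M J' (Y ω))) ∂P' ≤ ε + ε := by
  have hp0 : p ≠ 0 := (one_pos.trans_le (Fact.out (p := 1 ≤ p))).ne'
  refine le_of_tendsto (tendsto_lintegral_min_one_edist_of_tendstoInDistribution hY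
    (continuous_stepMap M J) (continuous_stepMap M J')) ?_
  filter_upwards [hJ, hJ'] with n hn hn'
  refine (lintegral_mono fun ω => (min_le_right _ _).trans
    (edist_stepMap_stepMap_le
      (measurable_combinedLocalTime (θ := θ) (t := t) (a n) n fun k => S k ω))).trans ?_
  rw [lintegral_add_left (measurable_stepError hS hp0 hp (a n) n M J)]
  exact add_le_add hn hn'

theorem eventually_lintegral_min_one_stepError_le [Fact (1 ≤ p)] (hS : ∀ k, Measurable (S k))
    (ha : Tendsto a atTop atTop) (hp : p ≠ ∞)
    (hY : TendstoInDistribution (fun (n : ℕ) (ω : Ω) => rescaledPath (a n) n fun k => S k ω)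
      atTop Y (fun _ => P) P')
    (h : ∀ i, VanishingLpModulus P S a p (t i)) {V : Ω' → ℝ → ℝ}
    (hV : ∀ᵐ ω ∂P', ∀ᵐ y, Tendsto (fun J => combinedStep θ t J (Y ω) y) atTop (𝓝 (V ω y)))
    (M : ℕ) {ε : ℝ≥0∞} (hε : 0 < ε) :
    ∀ᶠ J in atTop, ∫⁻ ω, min 1 (stepError p θ t M J (V ω) (Y ω)) ∂P' ≤ ε := by
  have h_walk := eventually_lintegral_stepError_le (θ := θ) hS ha Fact.out hp h M
    (ENNReal.half_pos hε.ne')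
  filter_upwards [h_walk] with J hJ
  have h_cauchy : ∀ᶠ J' in atTop,
      ∫⁻ ω, min 1 (edist (stepMap p θ t M J' (Y ω)) (stepMap p θ t M J (Y ω))) ∂P' ≤ ε := by
    filter_upwards [h_walk] with J' hJ'
    exact (lintegral_min_one_edist_stepMap_stepMap_le hS hp hY hJ' hJ).trans_eq
      (ENNReal.add_halves ε)
  have h_meas (J' : ℕ) : AEMeasurable (fun ω =>
      min 1 (edist (stepMap p θ t M J' (Y ω)) (stepMap p θ t M J (Y ω)))) P' :=
    (continuous_const.min ((continuous_stepMap M J').edist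
      (continuous_stepMap M J))).measurable.comp_aemeasurable hY.aemeasurable_limit
  calc ∫⁻ ω, min 1 (stepError p θ t M J (V ω) (Y ω)) ∂P'
      ≤ ∫⁻ ω, liminf (fun J' => min 1 (edist (stepMap p θ t M J' (Y ω))
          (stepMap p θ t M J (Y ω)))) atTop ∂P' :=
        lintegral_mono_ae (hV.mono fun ω hω => min_one_stepError_le_liminf hω M J)
    _ ≤ liminf (fun J' => ∫⁻ ω, min 1 (edist (stepMap p θ t M J' (Y ω))
          (stepMap p θ t M J (Y ω))) ∂P') atTop := lintegral_liminf_le' h_meas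
    _ ≤ ε := liminf_le_of_frequently_le' h_cauchy.frequently

theorem exists_lintegral_min_one_edist_stepMap_le
    (ha : Tendsto a atTop atTop) (hL : IsLocalTime P' Y L)
    (hY : TendstoInDistribution (fun (n : ℕ) (ω : Ω) => rescaledPath (a n) n fun k => S k ω)
      atTop Y (fun _ => P) P')
    {X : ℕ → Ω → Lp ℝ p (volume : Measure ℝ)} {Z : Ω' → Lp ℝ p (volume : Measure ℝ)}
    (hX : ∀ n ω, X n ω =ᵐ[volume] combinedLocalTime θ t (a n) n fun k => S k ω)
    (hZ : ∀ᵐ ω ∂P', Z ω =ᵐ[volume] fun y => ∑ i, θ i * L (t i) y ω)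
    (h_walk : ∀ M : ℕ, ∀ ε : ℝ≥0∞, 0 < ε → ∀ᶠ J in atTop, ∀ᶠ n in atTop,
      ∫⁻ ω, stepError p θ t M J (combinedLocalTime θ t (a n) n fun k => S k ω)
        (rescaledPath (a n) n fun k => S k ω) ∂P ≤ ε)
    (h_limit : ∀ M : ℕ, ∀ ε : ℝ≥0∞, 0 < ε → ∀ᶠ J in atTop, ∫⁻ ω, min 1 (stepError p θ t M J
      (fun y => ∑ i, θ i * L (t i) y ω) (Y ω)) ∂P' ≤ ε) {ε : ℝ≥0∞} (hε : 0 < ε) :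
    ∃ M J, (∀ᶠ n in atTop, ∫⁻ ω, min 1 (edist (X n ω)
        (stepMap p θ t M J (rescaledPath (a n) n fun k => S k ω))) ∂P ≤ ε) ∧
      ∫⁻ ω, min 1 (edist (Z ω) (stepMap p θ t M J (Y ω))) ∂P' ≤ ε := by
  have h_half : 0 < ε / 2 := ENNReal.half_pos hε.ne'
  have h_sup := hY.continuous_comp (SkorokhodSpace.continuous_averagedSup (Finset.univ.sup t))
  obtain ⟨K, hK, hK_walk⟩ := eventually_measure_le_of_tendstoInDistribution h_sup h_half
  have h_abs {x : SkorokhodSpace} (hx : ¬K ≤ SkorokhodSpace.averagedSup (Finset.univ.sup t) x)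
      (i : ι) (r : ℝ≥0) (hr : r ≤ t i) : |x r| < K :=
    (SkorokhodSpace.abs_le_averagedSup x (hr.trans (Finset.le_sup (Finset.mem_univ i)))).trans_lt
      (not_le.1 hx)
  obtain ⟨M, hM⟩ := exists_nat_ge (K + 1)
  obtain ⟨J, hJ_walk, hJ⟩ := ((h_walk M _ h_half).and (h_limit M _ h_half)).exists
  refine ⟨M, J, ?_, ?_⟩
  · filter_upwards [hK_walk, hJ_walk, ha.eventually_ge_atTop 1, eventually_ne_atTop 0]
      with n hn hn_err ha1 hn0
    refine ((lintegral_min_one_edist_stepMap_le (ae_of_all _ (hX n))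
      ((h_sup.forall_aemeasurable n).nullMeasurableSet_preimage measurableSet_Ici)
      (ae_of_all _ fun ω hω => ae_of_all _ fun y hy =>
        combinedLocalTime_eq_zero ha1 hn0 (h_abs hω) hM hy) J).trans (add_le_add hn
          ((lintegral_mono fun ω => min_le_right _ _).trans hn_err))).trans_eq ?_
    exact ENNReal.add_halves ε
  · refine ((lintegral_min_one_edist_stepMap_le hZ
      (h_sup.aemeasurable_limit.nullMeasurableSet_preimage measurableSet_Ici) ?_ J).trans
        (add_le_add hK hJ)).trans_eq (ENNReal.add_halves ε)
    filter_upwards [hL.ae_isOccupationDensity t] with ω hω hωK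
    exact IsOccupationDensity.ae_sum_mul_eq_zero hω (h_abs hωK) (by linarith)

end Limit

theorem proposition2p1_general {ι Ω Ω' : Type*} [Fintype ι] [MeasurableSpace Ω]
    [MeasurableSpace Ω'] (P : Measure Ω) [IsProbabilityMeasure P] (P' : Measure Ω')
    [IsProbabilityMeasure P'] (S : ℕ → Ω → ℤ) (hS : ∀ k, Measurable (S k)) (a : ℕ → ℝ)
    (ha : Tendsto a atTop atTop) (Y : Ω' → SkorokhodSpace) (L : ℝ≥0 → ℝ → Ω' → ℝ)
    (hL : IsLocalTime P' Y L)
    (hY : TendstoInDistribution (fun (n : ℕ) (ω : Ω) => rescaledPath (a n) n fun k => S k ω)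
      atTop Y (fun _ => P) P')
    (p : ℝ≥0∞) [Fact (1 ≤ p)] (hp : p ≠ ∞) (θ : ι → ℝ) (t : ι → ℝ≥0)
    (h : ∀ i, VanishingLpModulus P S a p (t i)) :
    ∃ (X : ℕ → Ω → Lp ℝ p (volume : Measure ℝ)) (Z : Ω' → Lp ℝ p (volume : Measure ℝ)),
      (∀ n ω, X n ω =ᵐ[volume]
        fun x => ∑ i, θ i * rescaledLocalTime (a n) n (fun k => S k ω) (t i) x) ∧
      (∀ᵐ ω ∂P', Z ω =ᵐ[volume] fun x => ∑ i, θ i * L (t i) x ω) ∧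
      TendstoInDistribution X atTop Z (fun _ => P) P' := by
  have h_walk (M : ℕ) (ε : ℝ≥0∞) (hε : 0 < ε) :=
    eventually_lintegral_stepError_le (θ := θ) hS ha Fact.out hp h M hε
  have h_limit (M : ℕ) (ε : ℝ≥0∞) (hε : 0 < ε) :=
    eventually_lintegral_min_one_stepError_le (θ := θ) hS ha hp hY h
      ((hL.ae_isOccupationDensity t).mono fun _ => IsOccupationDensity.ae_tendsto_combinedStep) M hε
  have : Fact (p ≠ ∞) := ⟨hp⟩
  have hp0 : p ≠ 0 := (one_pos.trans_le (Fact.out (p := 1 ≤ p))).ne'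
  let X (n : ℕ) (ω : Ω) : Lp ℝ p (volume : Measure ℝ) :=
    toLpOrZero p volume (combinedLocalTime θ t (a n) n fun k => S k ω)
  let Z (ω : Ω') : Lp ℝ p (volume : Measure ℝ) :=
    toLpOrZero p volume fun x => ∑ i, θ i * L (t i) x ω
  have hX (n : ℕ) (ω : Ω) : X n ω =ᵐ[volume] combinedLocalTime θ t (a n) n fun k => S k ω :=
    coeFn_toLpOrZero (memLp_combinedLocalTime (a n) n fun k => S k ω)
  have hZ : ∀ᵐ ω ∂P', Z ω =ᵐ[volume] fun x => ∑ i, θ i * L (t i) x ω :=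
    (hL.ae_memLp_sum_mul hp0 hp h_limit).mono fun _ => coeFn_toLpOrZero
  refine ⟨X, Z, hX, hZ, tendstoInDistribution_of_forall_approx
    (fun n =>
      (measurable_toLpOrZero hp (measurable_combinedLocalTime_prod hS (a n) n)).aemeasurable)
    (measurable_toLpOrZero hp hL.measurable_sum_mul).aemeasurable fun ε hε => ?_⟩
  obtain ⟨M, J, h_approx⟩ :=
    exists_lintegral_min_one_edist_stepMap_le ha hL hY hX hZ h_walk h_limit hε
  exact ⟨_, _, hY.continuous_comp (continuous_stepMap M J), h_approx⟩

theorem proposition2p1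
    {Ω Ω' : Type*} [MeasurableSpace Ω] [MeasurableSpace Ω']
    (P : Measure Ω) [IsProbabilityMeasure P] (P' : Measure Ω') [IsProbabilityMeasure P']
    -- the `ℤ`-valued random sequence
    (S : ℕ → Ω → ℤ) (hS : ∀ k, Measurable (S k))
    -- convergence of the rescaled walk in `D([0,∞))` to a process `Y` with local time `L`
    (a : ℕ → ℝ) (ha : Tendsto a atTop atTop)
    (ha' : Tendsto (fun n : ℕ => (n : ℝ)⁻¹ * a n) atTop (𝓝 0))
    (Y : Ω' → SkorokhodSpace) (L : ℝ≥0 → ℝ → Ω' → ℝ) (hL : IsLocalTime P' Y L)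
    (hY : TendstoInDistribution (fun (n : ℕ) (ω : Ω) => rescaledPath (a n) n fun k => S k ω)
      atTop Y (fun _ => P) P')
    -- `L^p` modulus of continuity of the rescaled discrete local time
    (p : ℝ≥0∞) [Fact (1 ≤ p)] (hp : p ≠ ∞)
    (hRW2 : ∀ t : ℝ≥0, 0 < t → ∀ M : ℝ, 0 < M →
      Tendsto (fun δ : ℝ => limsup (fun n : ℕ => ∫⁻ x in Icc (-M) M, ∫⁻ ω,
          ‖rescaledLocalTime (a n) n (fun k => S k ω) t x
            - rescaledLocalTime (a n) n (fun k => S k ω) t (gridFloor δ x)‖ₑ ^ p.toReal ∂P) atTop)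
        (𝓝[>] 0) (𝓝 0))
    (m : ℕ) (hm : 1 ≤ m) (θ : Fin m → ℝ) (t : Fin m → ℝ≥0) (ht0 : ∀ i, 0 < t i)
    (ht : StrictMono t) :
    ∃ (X : ℕ → Ω → Lp ℝ p (volume : Measure ℝ)) (Z : Ω' → Lp ℝ p (volume : Measure ℝ)),
      (∀ n ω, X n ω =ᵐ[volume]
        fun x => ∑ i, θ i * rescaledLocalTime (a n) n (fun k => S k ω) (t i) x) ∧
      (∀ᵐ ω ∂P', Z ω =ᵐ[volume] fun x => ∑ i, θ i * L (t i) x ω) ∧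
      TendstoInDistribution X atTop Z (fun _ => P) P' :=
  proposition2p1_general P P' S hS a ha Y L hL hY p hp θ t fun i => hRW2 (t i) (ht0 i)
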